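/- Let $H$ be a real separable Hilbert space with norm $\|\cdot\|$ and inner product $(\cdot,\cdot)$, and consider $$\ddot u(t)+k\dot u(t)+Au(t)+F(u(t))+M(u_t)=0,\quad t>0,\qquad u_0=\varphi,\qquad u_t(\theta)=u(t+\theta),\ \theta\in[-h,0],$$ in the phase space $W=W_h=C([-h,0];D(A^{1/2}))\cap C^1([-h,0];H)$ with norm $|\varphi|_W=\max_{\theta}\|A^{1/2}\varphi(\theta)\|+\max_\theta\|\dot\varphi(\theta)\|$. Assume: (A1) $A$ is a positive self-adjoint operator in $H$ with an orthonormal basis of eigenvectors $Ae_n=\mu_ne_n$, $0<\mu_1\le\mu_2\le\dots$, $\mu_n\to\infty$. (F1) $F:D(A^{1/2})\to H$ is locally Lipschitz: for every $R>0$ there is $L_R>0$ with $\|F(u^1)-F(u^2)\|\le L_R\|A^{1/2}(u^1-u^2)\|$ whenever $\|A^{1/2}u^i\|\le R$, $i=1,2$. (F2) $F=\Pi'+F^*$, where $\Pi'$ is the Fréchet derivative of a $C^1$-functional $\Pi=\Pi_0+\Pi_1:D(A^{1/2})\to\mathbb R$ ($D(A^{1/2})$ carrying the norm $\|A^{1/2}\cdot\|$,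 and $H$ being identified with a subspace of its dual); $F^*:D(A^{1/2})\to H$ satisfies $\|F^*(u^1)-F^*(u^2)\|^2\le c_0\|A^{1/2}(u^1-u^2)\|^2$ for some $c_0\ge 0$ and all $u^1,u^2\in D(A^{1/2})$; $\Pi_0\ge0$ is bounded on bounded sets; and for every $\eta>0$ there is $C_\eta>0$ with $|\Pi_1(u)|\le\eta(\|A^{1/2}u\|^2+\Pi_0(u))+C_\eta$ for all $u\in D(A^{1/2})$. (F3) (a) There are $\eta\in[0,1)$ and $c_4,c_5>0$ with $-(u,F(u))\le\eta\|A^{1/2}u\|^2-c_4\Pi_0(u)+c_5$ for all $u\in D(A^{1/2})$; (b) for every $\tilde\eta>0$ there is $C_{\tilde\eta}>0$ with $\|u\|^2\le C_{\tilde\eta}+\tilde\eta(\|A^{1/2}u\|^2+\Pi_0(u))$ for all $u\in D(A^{1/2})$; (c) there are $\hat\delta>0$ and $c_6,c_7\ge0$ with $\|F^*(u)\|^2\le c_6+c_7\|A^{1/2-\hat\delta}u\|^2$ for all $u\in D(A^{1/2})$. Let further $G:H\to H$ be globally Lipschitz. For given $h>0$, the admissible delay terms $M:W_h\to H$ are those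 which satisfy (M1) $M$ is locally Lipschitz: for every $\varrho>0$ there is $C_\varrho$ with $\|M(\varphi^1)-M(\varphi^2)\|\le C_\varrho|\varphi^1-\varphi^2|_W$ whenever $|\varphi^1|_W,|\varphi^2|_W\le\varrho$; and (M3) $M(\varphi)=G(\varphi(-\tau(\varphi)))$ for some $\tau:W_h\to[0,h]$. Put $\mathcal A(u,v)=(-v,Au+kv)$ on $D(\mathcal A)=D(A)\times D(A^{1/2})\subset Y=D(A^{1/2})\times H$. A global mild solution with initial datum $\varphi\in W$ is a function $u\in C([-h,\infty);D(A^{1/2}))\cap C^1([-h,\infty);H)$ such that $u_0=\varphi$ and $U=(u,\dot u)$ satisfies $$U(t)=e^{-t\mathcal A}U(0)+\int_0^te^{-(t-s)\mathcal A}\bigl(0,-F(u(s))-M(u_s)\bigr)\,ds,\qquad t\ge0,$$ where $e^{-t\mathcal A}$ is the $C_0$-semigroup on $Y$ generated by $-\mathcal A$. Then there is $\beta>0$, depending only on $A,F,F^*,\Pi_0,\Pi_1,G$, such that for every $k_0>0$ the following holds with $h_0=\beta k_0$. There is $R>0$, depending only on $k_0$ and $A,F,F^*,\Pi_0,\Pi_1,G$,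 such that for all $k\ge k_0$, all $h\in(0,h_0]$ and all delay terms $M$ satisfying (M1) and (M3): $-\mathcal A$ generates a $C_0$-semigroup on $Y$; every $\varphi\in W$ admits exactly one global mild solution $u$, so that the evolution operator $S_t\varphi=u_t$, $t\ge0$, is well defined on $W$; and $(S_t,W)$ is dissipative with radius $R$, i.e. for every $\varrho>0$ there is $t_\varrho>0$ such that $$|S_t\varphi|_W\le R\qquad\text{for all }\varphi\in W\text{ with }|\varphi|_W\le\varrho\text{ and all }t\ge t_\varrho .$$ In particular the absorbing radius $R$ is independent of $k\in[k_0,\infty)$ and of $h\in(0,h_0]$. -/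

import Mathlib

open Set Filter Topology MeasureTheory
open scoped NNReal

noncomputable section

namespace DelayWave

variable {H : Type*} [NormedAddCommGroup H] [InnerProductSpace ℝ H] [CompleteSpace H]

/-! ### The operator `A`, its powers and the space `D(A^{1/2})` -/

/-- A positive self-adjoint (unbounded) operator `A` with discrete spectrum in `H`, together with
an orthonormal basis `e n` of eigenvectors, `A (e n) = μ n • e n`,
`0 < μ 0 ≤ μ 1 ≤ …`, `μ n → ∞`. -/
structure PositiveDiscreteOperator (H : Type*) [NormedAddCommGroup H] [InnerProductSpace ℝ H]
    [CompleteSpace H] where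
  /-- the operator `A : D(A) → H` -/
  op : H →ₗ.[ℝ] H
  selfAdjoint : IsSelfAdjoint op
  /-- the eigenbasis -/
  e : HilbertBasis ℕ ℝ H
  /-- the eigenvalues -/
  μ : ℕ → ℝ
  μ_pos : ∀ n, 0 < μ n
  μ_mono : Monotone μ
  μ_tendsto : Tendsto μ atTop atTop
  e_mem : ∀ n, e n ∈ op.domain
  op_e : ∀ n, op ⟨e n, e_mem n⟩ = μ n • e n

namespace PositiveDiscreteOperator

variable (A : PositiveDiscreteOperator H)

/-- The domain `D(A^α)`: all `u` with `∑ n, |(μ n)^α (u, e n)|² < ∞`. -/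
def powDomain (α : ℝ) : Submodule ℝ H where
  carrier := {u | Memℓp (fun n => A.μ n ^ α * A.e.repr u n) 2}
  zero_mem' := by
    have h : (fun n => A.μ n ^ α * A.e.repr (0 : H) n) = (0 : ℕ → ℝ) := by
      ext n; simp
    simp only [mem_ofPred_eq, h]
    exact zero_memℓp
  add_mem' := by
    intro u v hu hv
    have h : (fun n => A.μ n ^ α * A.e.repr (u + v) n)
        = (fun n => A.μ n ^ α * A.e.repr u n) + fun n => A.μ n ^ α * A.e.repr v n := by
      ext n; simp [mul_add]
    simp only [mem_ofPred_eq, h]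
    exact Memℓp.add hu hv
  smul_mem' := by
    intro c u hu
    have h : (fun n => A.μ n ^ α * A.e.repr (c • u) n)
        = c • fun n => A.μ n ^ α * A.e.repr u n := by
      ext n; simp [mul_left_comm]
    simp only [mem_ofPred_eq, h]
    exact Memℓp.const_smul hu c

/-- The power `A^α : D(A^α) → H`, `A^α u = ∑ n, (μ n)^α (u, e n) e n`. -/
def pow (α : ℝ) : A.powDomain α →ₗ[ℝ] H where
  toFun u := A.e.repr.symm ⟨fun n => A.μ n ^ α * A.e.repr (u : H) n, u.2⟩
  map_add' u v := by
    rw [← map_add]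
    congr 1
    ext n
    change A.μ n ^ α * A.e.repr ((u : H) + (v : H)) n
      = A.μ n ^ α * A.e.repr (u : H) n + A.μ n ^ α * A.e.repr (v : H) n
    simp [mul_add]
  map_smul' c u := by
    rw [RingHom.id_apply, ← map_smul]
    congr 1
    ext n
    change A.μ n ^ α * A.e.repr (c • (u : H)) n = c * (A.μ n ^ α * A.e.repr (u : H) n)
    simp [mul_left_comm]

theorem repr_pow (α : ℝ) (u : A.powDomain α) (n : ℕ) :
    A.e.repr (A.pow α u) n = A.μ n ^ α * A.e.repr (u : H) n := by
  simp [pow]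

theorem pow_injective (α : ℝ) : Function.Injective (A.pow α) := by
  intro u v h
  apply Subtype.ext
  apply A.e.repr.injective
  ext n
  have h1 := A.repr_pow α u n
  rw [h, A.repr_pow α v n] at h1
  exact (mul_left_cancel₀ (Real.rpow_pos_of_pos (A.μ_pos n) α).ne' h1).symm

/-- The domains `D(A^α)` decrease in `α`. -/
theorem powDomain_anti {α β : ℝ} (hαβ : α ≤ β) : A.powDomain β ≤ A.powDomain α := by
  intro u hu
  have hu' : Memℓp (fun n => A.μ n ^ β * A.e.repr u n) 2 := hu
  have h := hu'.const_smul (A.μ 0 ^ (α - β))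
  show Memℓp (fun n => A.μ n ^ α * A.e.repr u n) 2
  rw [memℓp_gen_iff (by norm_num)] at h ⊢
  refine h.of_nonneg_of_le (fun n => by positivity) fun n => ?_
  have h0 := A.μ_pos 0
  have hn := A.μ_pos n
  have hle : A.μ n ^ α ≤ A.μ 0 ^ (α - β) * A.μ n ^ β := by
    have h1 : A.μ n ^ α = A.μ n ^ (α - β) * A.μ n ^ β := by
      rw [← Real.rpow_add hn]; ring_nf
    rw [h1]
    exact mul_le_mul_of_nonneg_right
      (Real.rpow_le_rpow_of_nonpos h0 (A.μ_mono (Nat.zero_le n)) (by linarith))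
      (Real.rpow_nonneg hn.le _)
  refine Real.rpow_le_rpow (norm_nonneg _) ?_ (by norm_num)
  have e1 : (A.μ 0 ^ (α - β) • fun n => A.μ n ^ β * A.e.repr u n) n
      = (A.μ 0 ^ (α - β) * A.μ n ^ β) * A.e.repr u n := by
    simp [mul_assoc]
  rw [e1, norm_mul, norm_mul]
  refine mul_le_mul_of_nonneg_right ?_ (norm_nonneg _)
  rw [Real.norm_of_nonneg (Real.rpow_nonneg hn.le _),
    Real.norm_of_nonneg (mul_nonneg (Real.rpow_nonneg h0.le _) (Real.rpow_nonneg hn.le _))]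
  exact hle

/-- The space `V = D(A^{1/2})`, equipped below with the norm `‖u‖ = ‖A^{1/2} u‖_H`. -/
def V : Type _ := A.powDomain (1 / 2)

instance : AddCommGroup A.V := inferInstanceAs (AddCommGroup (A.powDomain (1 / 2)))

instance : Module ℝ A.V := inferInstanceAs (Module ℝ (A.powDomain (1 / 2)))

/-- `A^{1/2}` as a linear map on `V`. -/
def sqrtA : A.V →ₗ[ℝ] H := A.pow (1 / 2)

instance : NormedAddCommGroup A.V :=
  NormedAddCommGroup.induced A.V H A.sqrtA (A.pow_injective (1 / 2))

instance : NormedSpace ℝ A.V := NormedSpace.induced ℝ A.V H A.sqrtA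

theorem norm_V (u : A.V) : ‖u‖ = ‖A.sqrtA u‖ := rfl

/-- The inclusion `D(A^{1/2}) ⊆ H`. -/
def incl : A.V →ₗ[ℝ] H := (A.powDomain (1 / 2)).subtype

/-- An element of `D(A^{1/2})` regarded as an element of `D(A^α)`, `α ≤ 1/2`. -/
def toPow (α : ℝ) (hα : α ≤ 1 / 2) (u : A.V) : A.powDomain α :=
  ⟨A.incl u, A.powDomain_anti hα (Subtype.prop (p := fun x => x ∈ A.powDomain (1 / 2)) u)⟩

/-! ### The first order operator and its semigroup -/

/-- `𝒜 (u, v) = (-v, A u + k v)` in `Y = D(A^{1/2}) × H`, with domain `D(A) × D(A^{1/2})`. For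
`U = (u, v)` the relation `InWaveGraph k U Z` says that `U` lies in the domain of `𝒜` and
`𝒜 U = Z`. -/
def InWaveGraph (k : ℝ) (U Z : A.V × H) : Prop :=
  ∃ (hu : A.incl U.1 ∈ A.op.domain) (w : A.V), A.incl w = U.2 ∧
    Z = (-w, A.op ⟨A.incl U.1, hu⟩ + k • U.2)

end PositiveDiscreteOperator

/-- A strongly continuous semigroup of bounded operators on a normed space; only the values at
`t ≥ 0` are meaningful. -/
structure IsC0Semigroup {Y : Type*} [NormedAddCommGroup Y] [NormedSpace ℝ Y]
    (T : ℝ → Y →L[ℝ] Y) : Prop where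
  zero : T 0 = ContinuousLinearMap.id ℝ Y
  add : ∀ s t, 0 ≤ s → 0 ≤ t → T (s + t) = (T s).comp (T t)
  cont : ∀ y, ContinuousOn (fun t => T t y) (Ici 0)

/-- `T t = e^{-t 𝒜}`: the family `T` is a `C₀`-semigroup on `Y` whose generator is `-𝒜`, that is,
the limit of `(T t U - U) / t` as `t ↓ 0` exists and equals `-Z` exactly when
`U ∈ D(𝒜)` and `𝒜 U = Z`. -/
structure IsWaveSemigroup (A : PositiveDiscreteOperator H) (k : ℝ)
    (T : ℝ → (A.V × H) →L[ℝ] (A.V × H)) : Prop where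
  isC0 : IsC0Semigroup T
  generator : ∀ U Z : A.V × H,
    Tendsto (fun t : ℝ => t⁻¹ • (T t U - U)) (𝓝[>] 0) (𝓝 (-Z)) ↔ A.InWaveGraph k U Z

/-! ### The phase space and trajectories -/

/-- The delay interval `[-h, 0]`. -/
abbrev DelayInterval (h : ℝ≥0) : Type := Icc (-(h : ℝ)) 0

/-- The phase space `W = C([-h,0]; D(A^{1/2})) ∩ C¹([-h,0]; H)`. Its elements are the pairs
`(φ, φ̇)` where `φ̇` is the derivative of `φ` in `H` (one-sided at the end points). -/
def phaseSpace (A : PositiveDiscreteOperator H) (h : ℝ≥0) :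
    Submodule ℝ (C(DelayInterval h, A.V) × C(DelayInterval h, H)) where
  carrier := {φ | ∀ θ : DelayInterval h,
    HasDerivWithinAt
      (fun s : ℝ => A.incl (IccExtend (neg_nonpos.2 h.coe_nonneg) φ.1 s)) (φ.2 θ)
      (Icc (-(h : ℝ)) 0) θ}
  zero_mem' := by
    intro θ
    simpa [IccExtend, Function.comp_def] using hasDerivWithinAt_const (θ : ℝ) _ (0 : H)
  add_mem' := by
    intro φ ψ hφ hψ θ
    simpa [IccExtend, Function.comp_def] using (hφ θ).fun_add (hψ θ)
  smul_mem' := by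
    intro c φ hφ θ
    simpa [IccExtend, Function.comp_def] using (hφ θ).fun_const_smul c

/-- The norm `|φ|_W = max_θ ‖A^{1/2} φ(θ)‖ + max_θ ‖φ̇(θ)‖`. -/
def wNorm {A : PositiveDiscreteOperator H} {h : ℝ≥0} (φ : phaseSpace A h) : ℝ :=
  ‖φ.1.1‖ + ‖φ.1.2‖

/-- The space `C([-h,∞); D(A^{1/2})) ∩ C¹([-h,∞); H)`, an element being recorded as a pair
`(u, u̇)`. -/
@[ext]
structure Trajectory (A : PositiveDiscreteOperator H) (h : ℝ≥0) where
  /-- the function `u` -/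
  pos : C(Ici (-(h : ℝ)), A.V)
  /-- its derivative `u̇` -/
  vel : C(Ici (-(h : ℝ)), H)
  hasDeriv : ∀ t : Ici (-(h : ℝ)),
    HasDerivWithinAt (fun s : ℝ => A.incl (IciExtend pos s)) (vel t) (Ici (-(h : ℝ))) t

namespace Trajectory

variable {A : PositiveDiscreteOperator H} {h : ℝ≥0}

/-- The point `t + θ ∈ [-h,∞)` for `t ≥ 0`, `θ ∈ [-h,0]`. -/
def shiftPt (t : ℝ≥0) (θ : DelayInterval h) : Ici (-(h : ℝ)) :=
  ⟨t + θ, by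
    have h1 := θ.2.1
    have h2 := t.coe_nonneg
    simp only [mem_Ici]
    linarith⟩

theorem continuous_shiftPt (t : ℝ≥0) : Continuous (shiftPt (h := h) t) :=
  (continuous_const.add continuous_subtype_val).subtype_mk _

/-- The segment `u_t ∈ W`, `u_t(θ) = u(t + θ)` for `θ ∈ [-h,0]`. -/
def segment (u : Trajectory A h) (t : ℝ≥0) : phaseSpace A h :=
  ⟨(u.pos.comp ⟨shiftPt t, continuous_shiftPt t⟩, u.vel.comp ⟨shiftPt t, continuous_shiftPt t⟩), by
    intro θ
    have h1 : HasDerivWithinAt (fun s : ℝ => A.incl (IciExtend u.pos s)) (u.vel (shiftPt t θ))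
        (Ici (-(h : ℝ))) ((t : ℝ) + θ) := u.hasDeriv (shiftPt t θ)
    have h2 : HasDerivWithinAt (fun s : ℝ => (t : ℝ) + s) 1 (Icc (-(h : ℝ)) 0) θ :=
      (hasDerivWithinAt_id _ _).const_add _
    have h3 := HasDerivWithinAt.scomp (θ : ℝ) h1 h2 (by
      intro s hs
      have := t.coe_nonneg
      simp only [mem_Ici]
      linarith [hs.1])
    rw [one_smul] at h3
    refine h3.congr_of_mem (fun s hs => ?_) θ.2
    have hs' : (t : ℝ) + s ∈ Ici (-(h : ℝ)) := by
      have := t.coe_nonneg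
      simp only [mem_Ici]
      linarith [hs.1]
    simp only [Function.comp_apply]
    rw [IccExtend_of_mem _ _ hs, IciExtend_of_mem _ hs']
    rfl⟩

/-- The pair `U(t) = (u(t), u̇(t)) ∈ Y = D(A^{1/2}) × H`, for `t ≥ 0`. -/
def state (u : Trajectory A h) (t : ℝ≥0) : A.V × H :=
  have ht : (t : ℝ) ∈ Ici (-(h : ℝ)) :=
    (neg_nonpos.2 h.coe_nonneg).trans t.coe_nonneg
  (u.pos ⟨t, ht⟩, u.vel ⟨t, ht⟩)

end Trajectory

/-- `u` is a (global) mild solution of `ü + k u̇ + A u + F(u) + M(u_t) = 0`, `t > 0`, `u_0 = φ`: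
with `T t = e^{-t 𝒜}` and `U = (u, u̇)`,
`U(t) = T t U(0) + ∫₀ᵗ T (t - s) (0, -F(u(s)) - M(u_s)) ds` for all `t ≥ 0`. -/
structure IsMildSolution {A : PositiveDiscreteOperator H} {h : ℝ≥0}
    (T : ℝ → (A.V × H) →L[ℝ] (A.V × H)) (F : A.V → H) (M : phaseSpace A h → H)
    (φ : phaseSpace A h) (u : Trajectory A h) : Prop where
  init : u.segment 0 = φ
  mild : ∀ t : ℝ≥0, u.state t = T t (u.state 0) +
    ∫ s in (0 : ℝ)..t,
      T (t - s) (0, -(F (u.state s.toNNReal).1 + M (u.segment s.toNNReal)))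

/-- `S` is the evolution operator of the problem: for every `φ ∈ W` there is exactly one global
mild solution `u` with `u_0 = φ`, and `S t φ = u_t`. -/
def IsEvolution {A : PositiveDiscreteOperator H} {h : ℝ≥0}
    (T : ℝ → (A.V × H) →L[ℝ] (A.V × H)) (F : A.V → H) (M : phaseSpace A h → H)
    (S : ℝ≥0 → phaseSpace A h → phaseSpace A h) : Prop :=
  ∀ φ : phaseSpace A h, (∃! u : Trajectory A h, IsMildSolution T F M φ u) ∧
    ∀ u : Trajectory A h, IsMildSolution T F M φ u → ∀ t : ℝ≥0, S t φ = u.segment t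

/-- The system `(S t, W)` is dissipative with dissipativity radius `R`. -/
def IsDissipativeWithRadius {A : PositiveDiscreteOperator H} {h : ℝ≥0}
    (S : ℝ≥0 → phaseSpace A h → phaseSpace A h) (R : ℝ) : Prop :=
  ∀ ρ : ℝ, 0 < ρ → ∃ tρ : ℝ≥0, 0 < tρ ∧
    ∀ φ : phaseSpace A h, wNorm φ ≤ ρ → ∀ t : ℝ≥0, tρ ≤ t → wNorm (S t φ) ≤ R

/-! ### The hypotheses on the nonlinearities -/

/-- `F : D(A^{1/2}) → H` is locally Lipschitz. -/
def HypF1 (A : PositiveDiscreteOperator H) (F : A.V → H) : Prop :=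
  ∀ R : ℝ, 0 < R → ∃ L : ℝ, 0 < L ∧
    ∀ u₁ u₂ : A.V, ‖u₁‖ ≤ R → ‖u₂‖ ≤ R → ‖F u₁ - F u₂‖ ≤ L * ‖u₁ - u₂‖

/-- `F = Π' + F*` where `Π = Π₀ + Π₁` is a `C¹`-functional on `D(A^{1/2})` and `F*` is globally
Lipschitz; `H` is identified with a subspace of the dual of `D(A^{1/2})`. -/
structure HypF2 (A : PositiveDiscreteOperator H) (F Fstar : A.V → H) (P0 P1 : A.V → ℝ) :
    Prop where
  contDiff : ContDiff ℝ 1 (fun u => P0 u + P1 u)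
  decomp : ∀ u v : A.V,
    inner ℝ (F u) (A.incl v)
      = fderiv ℝ (fun w => P0 w + P1 w) u v + inner ℝ (Fstar u) (A.incl v)
  lipschitz : ∃ c₀ : ℝ, 0 ≤ c₀ ∧ ∀ u₁ u₂ : A.V, ‖Fstar u₁ - Fstar u₂‖ ^ 2 ≤ c₀ * ‖u₁ - u₂‖ ^ 2
  nonneg : ∀ u, 0 ≤ P0 u
  bounded : ∀ r : ℝ, ∃ C : ℝ, ∀ u : A.V, ‖u‖ ≤ r → P0 u ≤ C
  small : ∀ η : ℝ, 0 < η → ∃ C : ℝ, 0 < C ∧ ∀ u : A.V, |P1 u| ≤ η * (‖u‖ ^ 2 + P0 u) + C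

/-- The dissipativity hypotheses on `F`. -/
structure HypF3 (A : PositiveDiscreteOperator H) (F Fstar : A.V → H) (P0 : A.V → ℝ) : Prop where
  coercive : ∃ η c₄ c₅ : ℝ, 0 ≤ η ∧ η < 1 ∧ 0 < c₄ ∧ 0 < c₅ ∧
    ∀ u : A.V, -inner ℝ (A.incl u) (F u) ≤ η * ‖u‖ ^ 2 - c₄ * P0 u + c₅
  lower : ∀ η : ℝ, 0 < η → ∃ C : ℝ, 0 < C ∧
    ∀ u : A.V, ‖A.incl u‖ ^ 2 ≤ C + η * (‖u‖ ^ 2 + P0 u)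
  subcritical : ∃ (δ c₆ c₇ : ℝ) (hδ : 0 < δ), 0 ≤ c₆ ∧ 0 ≤ c₇ ∧
    ∀ u : A.V, ‖Fstar u‖ ^ 2 ≤ c₆ +
      c₇ * ‖A.pow (1 / 2 - δ) (A.toPow (1 / 2 - δ) (by linarith) u)‖ ^ 2

/-- The delay term `M : W → H` is locally Lipschitz. -/
def HypM1 (A : PositiveDiscreteOperator H) (h : ℝ≥0) (M : phaseSpace A h → H) : Prop :=
  ∀ ρ : ℝ, 0 < ρ → ∃ C : ℝ, ∀ φ₁ φ₂ : phaseSpace A h, wNorm φ₁ ≤ ρ → wNorm φ₂ ≤ ρ →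
    ‖M φ₁ - M φ₂‖ ≤ C * wNorm (φ₁ - φ₂)

/-- Discrete state-dependent delay: `M(φ) = G(φ(-τ(φ)))` for some `τ : W → [0,h]`. -/
def HypM3 (A : PositiveDiscreteOperator H) (h : ℝ≥0) (G : H → H) (M : phaseSpace A h → H) :
    Prop :=
  ∃ τ : phaseSpace A h → Icc (0 : ℝ) h, ∀ φ : phaseSpace A h,
    M φ = G (A.incl (φ.1.1 ⟨-(τ φ : ℝ), neg_le_neg (τ φ).2.2, neg_nonpos.2 (τ φ).2.1⟩))

end DelayWave

end

/-!
The damped wave equation is diagonal in the eigenbasis of `A`: the `n`-th mode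
`√μ (u, e n) + i (u̇, e n)` evolves by a real-linear flow on `ℂ` which is a contraction for `t ≥ 0`
and grows at most like `exp (k |t|)` for `t ≤ 0`, uniformly in `n`. So `e^{-t 𝒜}` exists, even as a
group (`isWaveSemigroup_waveGroup`); that its generator is exactly `-𝒜` comes down to
`D(A) = {u | ∑ μ² (u, e n)² < ∞}`, which is self-adjointness. A mild solution is then the trajectory
`forcedTraj` determined by its history and its forcing term `f`, subject to
`f t = -(F (u t) + M (u_t))`. This fixed point equation lives in a space of functions with values in
`H`, without compatibility conditions between position and velocity, and is solved for a truncated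
force by contraction in an exponentially weighted norm (`exists_forcedTraj_of_lipschitz`); the same
weighted estimate gives uniqueness (`forcedTraj_unique`).

Mild solutions satisfy the energy identities exactly, by passing to the limit in Galerkin
projections (`hasDerivAt_energy`, `hasDerivAt_inner`, `hasDerivAt_potential`). Dissipativity follows
from the Lyapunov function
`½ (‖A^{1/2} u‖² + ‖u̇‖²) + Π(u) + (γ / k) ((u, u̇) + (k / 2) ‖u‖²)
  + (k / 8h) ∫₀ʰ ∫_{t-s}^t ‖u̇‖² ds`.
The delayed position is the present one minus an integral of `u̇` over the delay window. If `D` is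
the integral of `‖u̇‖²` over that window, the delay term therefore costs a multiple of
`L² h D / k`, where `L` is the Lipschitz constant of `G`, while the double integral gains
`k D / (8h)`; the cost is absorbed when `h ≤ β k₀` with `β` depending on `L` only. The factor
`γ / k`, with `γ` independent of `k`, makes all source terms as well as the decay rate proportional
to `1 / k` (`lyapunov_deriv_le`, `lyapunov_decay`): their quotient, the ultimate bound, does not
depend on `k`, although the rate of attraction does (`exists_energy_bound`). The same bound excludes
blow-up, hence a single truncation level suffices for a global solution
(`exists_global_forcedTraj`).
-/

noncomputable section

namespace DelayWave

variable {H : Type*} [NormedAddCommGroup H] [InnerProductSpace ℝ H] [CompleteSpace H]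

namespace PositiveDiscreteOperator

variable (A : PositiveDiscreteOperator H)

/-! ### Coordinates with respect to the eigenbasis -/

/-- The `n`-th Fourier coefficient `x ↦ (e n, x)`. -/
def coord (n : ℕ) : H →L[ℝ] ℝ := innerSL ℝ (A.e n)

theorem coord_apply (n : ℕ) (x : H) : A.coord n x = inner ℝ (A.e n) x := rfl

theorem coord_eq_repr (n : ℕ) (x : H) : A.coord n x = A.e.repr x n :=
  (A.e.repr_apply_apply x n).symm

theorem coord_ext {x y : H} (h : ∀ n, A.coord n x = A.coord n y) : x = y := by
  apply A.e.repr.injective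
  ext n
  simpa only [coord_eq_repr] using h n

theorem hasSum_coord_mul (x y : H) :
    HasSum (fun n => A.coord n x * A.coord n y) (inner ℝ x y) := by
  simpa only [coord_apply, real_inner_comm] using A.e.hasSum_inner_mul_inner x y

theorem hasSum_coord_sq (x : H) : HasSum (fun n => A.coord n x ^ 2) (‖x‖ ^ 2) := by
  simpa only [sq, real_inner_self_eq_norm_mul_norm] using A.hasSum_coord_mul x x

theorem exists_coord_eq {a : ℕ → ℝ} (ha : Summable fun n => a n ^ 2) :
    ∃ x : H, ∀ n, A.coord n x = a n := by
  have h : Memℓp a 2 := by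
    rw [memℓp_gen_iff (by norm_num)]
    simpa using ha
  exact ⟨A.e.repr.symm ⟨a, h⟩, fun n => by simp [coord_eq_repr]⟩

theorem mem_powDomain {α : ℝ} {x : H} :
    x ∈ A.powDomain α ↔ Summable fun n => (A.μ n ^ α * A.coord n x) ^ 2 := by
  change Memℓp (fun n => A.μ n ^ α * A.e.repr x n) 2 ↔ _
  rw [memℓp_gen_iff (by norm_num)]
  simp [coord_eq_repr, mul_pow]

/-- The frequency `√(μ n)` of the `n`-th mode, written as the power that defines `A^{1/2}`. -/
def freq (n : ℕ) : ℝ := A.μ n ^ (1 / 2 : ℝ)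

theorem freq_pos (n : ℕ) : 0 < A.freq n := Real.rpow_pos_of_pos (A.μ_pos n) _

theorem freq_sq (n : ℕ) : A.freq n ^ 2 = A.μ n := by
  rw [freq, ← Real.sqrt_eq_rpow, Real.sq_sqrt (A.μ_pos n).le]

theorem coord_sqrtA (n : ℕ) (u : A.V) :
    A.coord n (A.sqrtA u) = A.freq n * A.coord n (A.incl u) := by
  simp only [coord_eq_repr]
  exact A.repr_pow (1 / 2) u n

theorem incl_injective : Function.Injective A.incl := Subtype.val_injective

theorem exists_incl_eq {x : H} (hx : Summable fun n => (A.freq n * A.coord n x) ^ 2) :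
    ∃ u : A.V, A.incl u = x :=
  ⟨⟨x, A.mem_powDomain.2 hx⟩, rfl⟩

theorem sqrtA_surjective : Function.Surjective A.sqrtA := by
  intro y
  have hs : Summable fun n => ((A.freq n)⁻¹ * A.coord n y) ^ 2 := by
    refine Summable.of_nonneg_of_le (fun n => sq_nonneg _) (fun n => ?_)
      ((A.hasSum_coord_sq y).summable.mul_left (A.μ 0)⁻¹)
    rw [mul_pow, inv_pow, A.freq_sq]
    exact mul_le_mul_of_nonneg_right
      (inv_anti₀ (A.μ_pos 0) (A.μ_mono (Nat.zero_le n))) (sq_nonneg _)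
  obtain ⟨x, hx⟩ := A.exists_coord_eq hs
  obtain ⟨u, hu⟩ := A.exists_incl_eq (x := x) (by
    refine (A.hasSum_coord_sq y).summable.congr fun n => ?_
    rw [hx, mul_inv_cancel_left₀ (A.freq_pos n).ne'])
  refine ⟨u, A.coord_ext fun n => ?_⟩
  rw [coord_sqrtA, hu, hx, mul_inv_cancel_left₀ (A.freq_pos n).ne']

/-- `A^{1/2}` as an isometric isomorphism of `D(A^{1/2})` onto `H`. -/
def sqrtEquiv : A.V ≃ₗᵢ[ℝ] H :=
  LinearIsometryEquiv.ofSurjective ⟨A.sqrtA, fun _ => rfl⟩ A.sqrtA_surjective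

theorem sqrtEquiv_apply (u : A.V) : A.sqrtEquiv u = A.sqrtA u := rfl

instance : CompleteSpace A.V :=
  A.sqrtEquiv.toIsometryEquiv.completeSpace

theorem hasSum_freq_mul_coord_sq (u : A.V) :
    HasSum (fun n => (A.freq n * A.coord n (A.incl u)) ^ 2) (‖u‖ ^ 2) := by
  simpa only [coord_sqrtA, ← A.norm_V] using A.hasSum_coord_sq (A.sqrtA u)

theorem norm_incl_sq_le (u : A.V) : ‖A.incl u‖ ^ 2 ≤ (A.μ 0)⁻¹ * ‖u‖ ^ 2 := by
  refine hasSum_le (fun n => ?_) (A.hasSum_coord_sq (A.incl u))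
    ((A.hasSum_freq_mul_coord_sq u).mul_left (A.μ 0)⁻¹)
  rw [mul_pow, A.freq_sq, ← mul_assoc]
  refine le_mul_of_one_le_left (sq_nonneg _) ?_
  rw [inv_mul_eq_div, one_le_div (A.μ_pos 0)]
  exact A.μ_mono (Nat.zero_le n)

/-- The inclusion `D(A^{1/2}) ⊆ H` as a bounded operator. -/
def inclL : A.V →L[ℝ] H :=
  A.incl.mkContinuous (√(A.μ 0)⁻¹) fun u => by
    rw [← abs_of_nonneg (norm_nonneg (A.incl u)),
      ← abs_of_nonneg (mul_nonneg (Real.sqrt_nonneg (A.μ 0)⁻¹) (norm_nonneg u))]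
    refine sq_le_sq.1 ?_
    rw [mul_pow, Real.sq_sqrt (inv_nonneg.2 (A.μ_pos 0).le)]
    exact A.norm_incl_sq_le u

theorem continuous_incl : Continuous A.incl := A.inclL.continuous

/-- The `n`-th mode `√(μ n) (u, e n) + i (v, e n)` of a state `(u, v)`. In these coordinates the
energy `‖A^{1/2} u‖² + ‖v‖²` is the sum of the squared moduli. -/
def mode (n : ℕ) : A.V × H →L[ℝ] ℂ :=
  (Complex.equivRealProdCLM.symm : ℝ × ℝ →L[ℝ] ℂ).comp
    (((A.coord n).comp ((A.sqrtEquiv.toContinuousLinearEquiv : A.V →L[ℝ] H).comp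
      (ContinuousLinearMap.fst ℝ A.V H))).prod
      ((A.coord n).comp (ContinuousLinearMap.snd ℝ A.V H)))

@[simp] theorem mode_re (n : ℕ) (U : A.V × H) :
    (A.mode n U).re = A.freq n * A.coord n (A.incl U.1) := by
  rw [← coord_sqrtA]; simp [mode, sqrtEquiv_apply]

@[simp] theorem mode_im (n : ℕ) (U : A.V × H) : (A.mode n U).im = A.coord n U.2 := by
  simp [mode]

theorem hasSum_norm_mode_sq (U : A.V × H) :
    HasSum (fun n => ‖A.mode n U‖ ^ 2) (‖U.1‖ ^ 2 + ‖U.2‖ ^ 2) := by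
  refine ((A.hasSum_freq_mul_coord_sq U.1).add (A.hasSum_coord_sq U.2)).congr_fun ?_
  intro n
  rw [Complex.sq_norm, Complex.normSq_apply, mode_re, mode_im]
  ring

theorem mode_ext {U U' : A.V × H} (h : ∀ n, A.mode n U = A.mode n U') : U = U' := by
  refine Prod.ext (A.incl_injective (A.coord_ext fun n => ?_)) (A.coord_ext fun n => ?_)
  · have := congrArg Complex.re (h n)
    simpa only [mode_re, mul_right_inj' (A.freq_pos n).ne'] using this
  · have := congrArg Complex.im (h n)
    simpa only [mode_im] using this

theorem exists_mode_eq {z : ℕ → ℂ} (hz : Summable fun n => ‖z n‖ ^ 2) :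
    ∃ U : A.V × H, ∀ n, A.mode n U = z n := by
  obtain ⟨a, ha⟩ := A.exists_coord_eq (a := fun n => (z n).re)
    (Summable.of_nonneg_of_le (fun n => sq_nonneg _) (fun n => by
      rw [Complex.sq_norm, Complex.normSq_apply]; nlinarith [sq_nonneg (z n).im]) hz)
  obtain ⟨b, hb⟩ := A.exists_coord_eq (a := fun n => (z n).im)
    (Summable.of_nonneg_of_le (fun n => sq_nonneg _) (fun n => by
      rw [Complex.sq_norm, Complex.normSq_apply]; nlinarith [sq_nonneg (z n).re]) hz)
  obtain ⟨u, rfl⟩ := A.sqrtA_surjective a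
  refine ⟨(u, b), fun n => Complex.ext ?_ ?_⟩
  · rw [mode_re, ← coord_sqrtA, ha]
  · rw [mode_im, hb]

theorem norm_sq_le_of_hasSum {U : A.V × H} {s : ℝ}
    (h : HasSum (fun n => ‖A.mode n U‖ ^ 2) s) : ‖U‖ ^ 2 ≤ s := by
  rw [h.unique (A.hasSum_norm_mode_sq U), Prod.norm_def]
  rcases max_cases ‖U.1‖ ‖U.2‖ with h | h <;> rw [h.1] <;>
    nlinarith [sq_nonneg ‖U.1‖, sq_nonneg ‖U.2‖]

/-- Dominated convergence in the state space: convergence of every mode together with a square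
summable bound gives convergence in norm. -/
theorem tendsto_of_mode {α : Type*} {l : Filter α} {f : α → A.V × H} {U : A.V × H}
    {b : ℕ → ℝ} (hb : Summable fun n => b n ^ 2)
    (hlim : ∀ n, Tendsto (fun t => A.mode n (f t)) l (𝓝 (A.mode n U)))
    (hbd : ∀ᶠ t in l, ∀ n, ‖A.mode n (f t)‖ ≤ b n) : Tendsto f l (𝓝 U) := by
  have hsum : Summable fun n => 2 * (b n ^ 2 + ‖A.mode n U‖ ^ 2) :=
    (hb.add (A.hasSum_norm_mode_sq U).summable).mul_left 2
  have h0 : ∀ n, Tendsto (fun t => ‖A.mode n (f t - U)‖ ^ 2) l (𝓝 0) := by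
    intro n
    have h1 : Tendsto (fun t => A.mode n (f t) - A.mode n U) l (𝓝 0) := by
      simpa using (hlim n).sub_const (A.mode n U)
    simpa using (h1.norm.pow 2)
  have h1 := tendsto_tsum_of_dominated_convergence hsum h0 (by
    filter_upwards [hbd] with t ht n
    rw [Real.norm_of_nonneg (sq_nonneg _), map_sub]
    have h1 := norm_sub_le (A.mode n (f t)) (A.mode n U)
    have h2 := ht n
    have h3 := norm_nonneg (A.mode n (f t))
    have h4 := norm_nonneg (A.mode n U)
    have h5 := norm_nonneg (A.mode n (f t) - A.mode n U)
    nlinarith [sq_nonneg (b n - ‖A.mode n U‖)])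
  rw [tsum_zero] at h1
  rw [tendsto_iff_norm_sub_tendsto_zero]
  have h2 : Tendsto (fun t => ‖f t - U‖ ^ 2) l (𝓝 0) :=
    squeeze_zero (fun t => sq_nonneg _)
      (fun t => A.norm_sq_le_of_hasSum (A.hasSum_norm_mode_sq _).summable.hasSum) h1
  have h3 := (Real.continuous_sqrt.tendsto 0).comp h2
  simpa [Function.comp_def, Real.sqrt_sq (norm_nonneg _)] using h3

end PositiveDiscreteOperator

namespace PositiveDiscreteOperator

variable (A : PositiveDiscreteOperator H) (k : ℝ)

/-! ### The propagator of a single mode -/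

/-- The generator of the `n`-th mode: `ü + k u̇ + μ u = 0` reads `ż = modeGen z` for
`z = √μ u + i u̇`. -/
def modeGen (n : ℕ) : ℂ →L[ℝ] ℂ :=
  (Complex.equivRealProdCLM.symm : ℝ × ℝ →L[ℝ] ℂ).comp
    ((A.freq n • Complex.imCLM).prod (-(A.freq n • Complex.reCLM) - k • Complex.imCLM))

@[simp] theorem modeGen_re (n : ℕ) (z : ℂ) : (A.modeGen k n z).re = A.freq n * z.im := by
  simp [modeGen]

@[simp] theorem modeGen_im (n : ℕ) (z : ℂ) :
    (A.modeGen k n z).im = -(A.freq n * z.re) - k * z.im := by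
  simp [modeGen]

/-- The propagator of the `n`-th mode, defined for all real times. -/
def modeProp (n : ℕ) (t : ℝ) : ℂ →L[ℝ] ℂ := NormedSpace.exp (t • A.modeGen k n)

@[simp] theorem modeProp_zero (n : ℕ) : A.modeProp k n 0 = 1 := by
  have h : (0 : ℝ) • A.modeGen k n = 0 := by ext; simp
  rw [modeProp, h, NormedSpace.exp_zero]

theorem exp_add_smul {𝔸 : Type*} [NormedRing 𝔸] [NormedAlgebra ℝ 𝔸] [CompleteSpace 𝔸] (s t : ℝ)
    (x : 𝔸) : NormedSpace.exp ((s + t) • x) = NormedSpace.exp (s • x) * NormedSpace.exp (t • x) := by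
  let _ : NormedAlgebra ℚ 𝔸 := NormedAlgebra.restrictScalars ℚ ℝ _
  rw [add_smul, NormedSpace.exp_add_of_commute]
  exact ((Commute.refl x).smul_left s).smul_right t

theorem modeProp_add (n : ℕ) (s t : ℝ) :
    A.modeProp k n (s + t) = A.modeProp k n s * A.modeProp k n t :=
  exp_add_smul s t (A.modeGen k n)

theorem hasDerivAt_modeProp (n : ℕ) (t : ℝ) :
    HasDerivAt (A.modeProp k n) (A.modeGen k n * A.modeProp k n t) t :=
  hasDerivAt_exp_smul_const' (A.modeGen k n) t

theorem hasDerivAt_modeProp_apply (n : ℕ) (z : ℂ) (t : ℝ) :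
    HasDerivAt (fun s => A.modeProp k n s z) (A.modeGen k n (A.modeProp k n t z)) t :=
  (A.hasDerivAt_modeProp k n t).clm_apply (hasDerivAt_const t z) |>.congr_deriv (by simp)

theorem modeProp_modeGen (n : ℕ) (t : ℝ) (z : ℂ) :
    A.modeProp k n t (A.modeGen k n z) = A.modeGen k n (A.modeProp k n t z) := by
  have h := (hasDerivAt_exp_smul_const (A.modeGen k n) t).unique (A.hasDerivAt_modeProp k n t)
  exact congrArg (fun L : ℂ →L[ℝ] ℂ => L z) h

theorem hasDerivAt_norm_sq_modeProp (n : ℕ) (z : ℂ) (t : ℝ) :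
    HasDerivAt (fun s => ‖A.modeProp k n s z‖ ^ 2) (-2 * k * (A.modeProp k n t z).im ^ 2) t := by
  have h := A.hasDerivAt_modeProp_apply k n z t
  have hre := Complex.reCLM.hasFDerivAt.comp_hasDerivAt t h
  have him := Complex.imCLM.hasFDerivAt.comp_hasDerivAt t h
  refine (((hre.mul hre).add (him.mul him)).congr_deriv ?_).congr_of_eventuallyEq ?_
  · simp only [Complex.reCLM_apply, Complex.imCLM_apply, Function.comp_apply, modeGen_re,
      modeGen_im]
    ring
  · refine Eventually.of_forall fun s => ?_
    simp [Complex.sq_norm, Complex.normSq_apply]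

variable {k}

/-- Each mode loses energy: the propagator is a contraction for `t ≥ 0`. -/
theorem norm_modeProp_le (hk : 0 ≤ k) (n : ℕ) {t : ℝ} (ht : 0 ≤ t) (z : ℂ) :
    ‖A.modeProp k n t z‖ ≤ ‖z‖ := by
  have h := antitone_of_deriv_nonpos
    (fun s => (A.hasDerivAt_norm_sq_modeProp k n z s).differentiableAt) (fun s => by
      rw [(A.hasDerivAt_norm_sq_modeProp k n z s).deriv]
      nlinarith [mul_nonneg hk (sq_nonneg (A.modeProp k n s z).im)])
  have h1 := h ht
  simp only [modeProp_zero, one_apply_eq_self] at h1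
  exact (sq_le_sq₀ (norm_nonneg _) (norm_nonneg _)).1 h1

/-- Backwards in time the modes grow at most like `exp (k |t|)`, uniformly in the mode. -/
theorem norm_modeProp_le_exp (hk : 0 ≤ k) (n : ℕ) (t : ℝ) (z : ℂ) :
    ‖A.modeProp k n t z‖ ≤ Real.exp (k * |t|) * ‖z‖ := by
  rcases le_total 0 t with ht | ht
  · refine (A.norm_modeProp_le hk n ht z).trans (le_mul_of_one_le_left (norm_nonneg _) ?_)
    exact Real.one_le_exp (by positivity)
  · have hd : ∀ s : ℝ, HasDerivAt (fun s => Real.exp (2 * k * s) * ‖A.modeProp k n s z‖ ^ 2)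
        (Real.exp (2 * k * s) * (2 * k * (A.modeProp k n s z).re ^ 2)) s := by
      intro s
      have h1 : HasDerivAt (fun s => Real.exp (2 * k * s)) (Real.exp (2 * k * s) * (2 * k)) s := by
        simpa using ((hasDerivAt_id s).const_mul (2 * k)).exp
      refine (h1.mul (A.hasDerivAt_norm_sq_modeProp k n z s)).congr_deriv ?_
      rw [Complex.sq_norm, Complex.normSq_apply]
      ring
    have h := monotone_of_deriv_nonneg (fun s => (hd s).differentiableAt) (fun s => by
      rw [(hd s).deriv]; positivity)
    have h1 := h ht
    simp only [modeProp_zero, one_apply_eq_self, mul_zero, Real.exp_zero,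
      one_mul] at h1
    have h2 : (Real.exp (k * t) * ‖A.modeProp k n t z‖) ^ 2 ≤ ‖z‖ ^ 2 := by
      refine le_trans (le_of_eq ?_) h1
      rw [mul_pow, ← Real.exp_nat_mul]
      push_cast; ring_nf
    have h3 := (sq_le_sq₀ (by positivity) (norm_nonneg _)).1 h2
    rw [abs_of_nonpos ht, mul_neg, Real.exp_neg, inv_mul_eq_div, le_div_iff₀ (Real.exp_pos _),
      mul_comm]
    exact h3

/-! ### The wave group -/

variable (k) in
theorem exists_propagate (hk : 0 ≤ k) (t : ℝ) (U : A.V × H) :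
    ∃ U' : A.V × H, ∀ n, A.mode n U' = A.modeProp k n t (A.mode n U) :=
  A.exists_mode_eq <| Summable.of_nonneg_of_le (fun n => sq_nonneg _) (fun n => by
    rw [← mul_pow]
    exact pow_le_pow_left₀ (norm_nonneg _) (A.norm_modeProp_le_exp hk n t _) 2)
    ((A.hasSum_norm_mode_sq U).summable.mul_left (Real.exp (k * |t|) ^ 2))

theorem norm_le_of_mode_le {U U' : A.V × H} {c : ℝ} (hc : 0 ≤ c)
    (h : ∀ n, ‖A.mode n U'‖ ≤ c * ‖A.mode n U‖) : ‖U'‖ ≤ 2 * c * ‖U‖ := by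
  have h1 : ‖U'.1‖ ^ 2 + ‖U'.2‖ ^ 2 ≤ c ^ 2 * (‖U.1‖ ^ 2 + ‖U.2‖ ^ 2) := by
    refine hasSum_le (fun n => ?_) (A.hasSum_norm_mode_sq U')
      ((A.hasSum_norm_mode_sq U).mul_left (c ^ 2))
    rw [← mul_pow]
    exact pow_le_pow_left₀ (norm_nonneg _) (h n) 2
  have h2 : ‖U'‖ ^ 2 ≤ ‖U'.1‖ ^ 2 + ‖U'.2‖ ^ 2 :=
    A.norm_sq_le_of_hasSum (A.hasSum_norm_mode_sq U')
  have h3 : ‖U.1‖ ^ 2 ≤ ‖U‖ ^ 2 := pow_le_pow_left₀ (norm_nonneg _) (norm_fst_le U) 2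
  have h4 : ‖U.2‖ ^ 2 ≤ ‖U‖ ^ 2 := pow_le_pow_left₀ (norm_nonneg _) (norm_snd_le U) 2
  refine (sq_le_sq₀ (norm_nonneg _) (by positivity)).1 ?_
  have h5 := mul_le_mul_of_nonneg_left (add_le_add h3 h4) (sq_nonneg c)
  nlinarith [mul_nonneg (sq_nonneg c) (sq_nonneg ‖U‖)]

/-- The group `e^{-t 𝒜}`. Since the damping is a bounded perturbation, the modes can be propagated
in both time directions, so that the operators are meaningful for all real `t`. -/
def waveGroup (hk : 0 ≤ k) (t : ℝ) : A.V × H →L[ℝ] A.V × H :=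
  LinearMap.mkContinuous
    { toFun := fun U => (A.exists_propagate k hk t U).choose
      map_add' := fun U U' => A.mode_ext fun n => by
        rw [(A.exists_propagate k hk t _).choose_spec n]
        simp only [map_add, (A.exists_propagate k hk t _).choose_spec n]
      map_smul' := fun c U => A.mode_ext fun n => by
        rw [(A.exists_propagate k hk t _).choose_spec n]
        simp only [map_smul, (A.exists_propagate k hk t _).choose_spec n, RingHom.id_apply] }
    (2 * Real.exp (k * |t|)) fun U => A.norm_le_of_mode_le (Real.exp_pos _).le fun n => by
      simp only [LinearMap.coe_mk, AddHom.coe_mk, (A.exists_propagate k hk t _).choose_spec n]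
      exact A.norm_modeProp_le_exp hk n t _

variable (hk : 0 ≤ k)

@[simp] theorem mode_waveGroup (t : ℝ) (U : A.V × H) (n : ℕ) :
    A.mode n (A.waveGroup hk t U) = A.modeProp k n t (A.mode n U) :=
  (A.exists_propagate k hk t U).choose_spec n

theorem waveGroup_zero : A.waveGroup hk 0 = ContinuousLinearMap.id ℝ _ :=
  ContinuousLinearMap.ext fun U => A.mode_ext fun n => by simp

theorem waveGroup_add (s t : ℝ) :
    A.waveGroup hk (s + t) = (A.waveGroup hk s).comp (A.waveGroup hk t) :=
  ContinuousLinearMap.ext fun U => A.mode_ext fun n => by simp [modeProp_add]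

theorem norm_waveGroup_le {t : ℝ} (ht : 0 ≤ t) (U : A.V × H) :
    ‖A.waveGroup hk t U‖ ≤ 2 * ‖U‖ := by
  simpa using A.norm_le_of_mode_le zero_le_one fun n => by
    simpa using A.norm_modeProp_le hk n ht (A.mode n U)

theorem norm_waveGroup_le_exp (t : ℝ) (U : A.V × H) :
    ‖A.waveGroup hk t U‖ ≤ 2 * Real.exp (k * |t|) * ‖U‖ :=
  A.norm_le_of_mode_le (Real.exp_pos _).le fun n => by
    simpa using A.norm_modeProp_le_exp hk n t (A.mode n U)

theorem continuous_waveGroup_apply (U : A.V × H) : Continuous fun t => A.waveGroup hk t U := by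
  rw [continuous_iff_continuousAt]
  intro t
  refine A.tendsto_of_mode (b := fun n => Real.exp (k * (|t| + 1)) * ‖A.mode n U‖) ?_ ?_ ?_
  · simp only [mul_pow]
    exact (A.hasSum_norm_mode_sq U).summable.mul_left _
  · intro n
    simp only [mode_waveGroup]
    exact (A.hasDerivAt_modeProp_apply k n _ t).continuousAt
  · filter_upwards [Metric.ball_mem_nhds t one_pos] with s hs n
    rw [mode_waveGroup]
    refine (A.norm_modeProp_le_exp hk n s _).trans ?_
    refine mul_le_mul_of_nonneg_right (Real.exp_le_exp.2 ?_) (norm_nonneg _)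
    refine mul_le_mul_of_nonneg_left ?_ hk
    rw [Metric.mem_ball, Real.dist_eq] at hs
    have := abs_sub_abs_le_abs_sub s t
    linarith

/-- Strong continuity and local boundedness give joint continuity. -/
theorem continuous_waveGroup_comp {α : Type*} [TopologicalSpace α] {g : α → ℝ}
    {y : α → A.V × H} (hg : Continuous g) (hy : Continuous y) :
    Continuous fun a => A.waveGroup hk (g a) (y a) := by
  rw [continuous_iff_continuousAt]
  intro a
  have h1 : Tendsto (fun b => A.waveGroup hk (g b) (y b - y a)) (𝓝 a) (𝓝 0) := by
    have h2 : Tendsto (fun b => 2 * Real.exp (k * |g b|) * ‖y b - y a‖) (𝓝 a) (𝓝 0) := by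
      have hc : Continuous fun b => 2 * Real.exp (k * |g b|) * ‖y b - y a‖ := by fun_prop
      simpa using hc.tendsto a
    exact squeeze_zero_norm (fun b => A.norm_waveGroup_le_exp hk _ _) h2
  have h3 : Tendsto (fun b => A.waveGroup hk (g b) (y a)) (𝓝 a)
      (𝓝 (A.waveGroup hk (g a) (y a))) :=
    ((A.continuous_waveGroup_apply hk (y a)).comp hg).tendsto a
  have h4 := h1.add h3
  simp only [← map_add, sub_add_cancel, zero_add] at h4
  exact h4

/-! ### The generator -/

theorem coord_op (u : A.op.domain) (n : ℕ) :
    A.coord n (A.op u) = A.μ n * A.coord n (u : H) := by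
  have hf : A.op.IsFormalAdjoint A.op := by
    have h := LinearPMap.adjoint_isFormalAdjoint A.selfAdjoint.dense_domain
    rwa [LinearPMap.isSelfAdjoint_def.1 A.selfAdjoint] at h
  have h := hf ⟨A.e n, A.e_mem n⟩ u
  rw [coord_apply, coord_apply, ← h, A.op_e, real_inner_smul_left]

/-- By self-adjointness `D(A)` contains every `u` with `∑ μ² (u, e n)² < ∞`. -/
theorem mem_domain_of_coord {u y : H} (h : ∀ n, A.coord n y = A.μ n * A.coord n u) :
    u ∈ A.op.domain := by
  rw [← LinearPMap.isSelfAdjoint_def.1 A.selfAdjoint]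
  refine LinearPMap.mem_adjoint_domain_of_exists u ⟨y, fun x => ?_⟩
  refine (A.hasSum_coord_mul y x).unique (HasSum.congr_fun (A.hasSum_coord_mul u (A.op x)) ?_)
  intro n
  rw [h, A.coord_op]
  ring

theorem inWaveGraph_iff (U Z : A.V × H) :
    A.InWaveGraph k U Z ↔ ∀ n, A.mode n Z = -A.modeGen k n (A.mode n U) := by
  constructor
  · rintro ⟨hu, w, hw, rfl⟩ n
    refine Complex.ext ?_ ?_
    · simp [hw]
    · simp only [mode_im, map_add, map_smul, A.coord_op, Complex.neg_im, modeGen_im, mode_re,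
        ← A.freq_sq, smul_eq_mul]
      ring
  · intro h
    have hre : ∀ n, A.coord n (A.incl Z.1) = -A.coord n U.2 := fun n => by
      have := congrArg Complex.re (h n)
      simp only [mode_re, Complex.neg_re, modeGen_re, mode_im, ← mul_neg] at this
      exact mul_left_cancel₀ (A.freq_pos n).ne' this
    have him : ∀ n, A.coord n (Z.2 - k • U.2) = A.μ n * A.coord n (A.incl U.1) := fun n => by
      have := congrArg Complex.im (h n)
      simp only [mode_im, Complex.neg_im, modeGen_im, mode_re] at this
      rw [map_sub, map_smul, this, ← A.freq_sq, smul_eq_mul]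
      ring
    have hu := A.mem_domain_of_coord him
    refine ⟨hu, -Z.1, A.coord_ext fun n => ?_, Prod.ext (neg_neg _).symm (A.coord_ext fun n => ?_)⟩
    · rw [map_neg, map_neg, hre, neg_neg]
    · change A.coord n Z.2 = A.coord n (A.op ⟨A.incl U.1, hu⟩ + k • U.2)
      rw [map_add, A.coord_op, ← him, map_sub, sub_add_cancel]

theorem isWaveSemigroup_waveGroup : IsWaveSemigroup A k (A.waveGroup hk) where
  isC0 :=
    { zero := A.waveGroup_zero hk
      add := fun s t _ _ => A.waveGroup_add hk s t
      cont := fun y => (A.continuous_waveGroup_apply hk y).continuousOn }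
  generator := by
    intro U Z
    rw [A.inWaveGraph_iff]
    have hlim : ∀ n, Tendsto (fun t : ℝ => A.mode n (t⁻¹ • (A.waveGroup hk t U - U))) (𝓝[>] 0)
        (𝓝 (A.modeGen k n (A.mode n U))) := by
      intro n
      have h := (A.hasDerivAt_modeProp_apply k n (A.mode n U) 0).tendsto_slope_zero_right
      simpa using h
    constructor
    · intro h n
      have h1 := (((A.mode n).continuous.tendsto _).comp h)
      rw [map_neg] at h1
      have h2 := tendsto_nhds_unique h1 (hlim n)
      rw [← h2, neg_neg]
    · intro h
      refine A.tendsto_of_mode (b := fun n => ‖A.mode n Z‖)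
        (A.hasSum_norm_mode_sq Z).summable (fun n => ?_) ?_
      · rw [map_neg, h n, neg_neg]
        exact hlim n
      -- the mean value inequality bounds the difference quotients by the derivative at `0`
      · filter_upwards [self_mem_nhdsWithin] with t ht n
        have ht : 0 < t := ht
        have hmv := Convex.norm_image_sub_le_of_norm_hasDerivWithin_le (s := Icc 0 t)
          (f := fun s => A.modeProp k n s (A.mode n U)) (C := ‖A.mode n Z‖) (x := 0) (y := t)
          (fun s _ => (A.hasDerivAt_modeProp_apply k n (A.mode n U) s).hasDerivWithinAt)
          (fun s hs => by
            rw [← A.modeProp_modeGen, ← neg_neg (A.modeGen k n (A.mode n U)), ← h n, map_neg,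
              norm_neg]
            exact A.norm_modeProp_le hk n hs.1 _)
          (convex_Icc 0 t) (left_mem_Icc.2 ht.le) (right_mem_Icc.2 ht.le)
        simp only [modeProp_zero, one_apply_eq_self, sub_zero] at hmv
        rw [map_smul, map_sub, mode_waveGroup, norm_smul, norm_inv, inv_mul_le_iff₀ (norm_pos_iff.2 ht.ne'),
          mul_comm]
        exact hmv

end PositiveDiscreteOperator

namespace PositiveDiscreteOperator

variable (A : PositiveDiscreteOperator H)

/-! ### The linear equation with a forcing term -/

/-- The solution of the linear equation `U̇ + 𝒜 U = (0, f)` with initial state `U₀`. Because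
`e^{-t 𝒜}` is a group, the variation of constants formula can be written without a
convolution. -/
def linSol {k : ℝ} (hk : 0 ≤ k) (U₀ : A.V × H) (f : ℝ → H) (t : ℝ) : A.V × H :=
  A.waveGroup hk t (U₀ + ∫ s in (0 : ℝ)..t, A.waveGroup hk (-s) (0, f s))

/-- Every mode of `(u, v)` solves the forced oscillator equation `p' = q`,
`q' = -μ p - k q + (f, e n)`. -/
structure IsModalSolution (k : ℝ) (f : ℝ → H) (u : ℝ → A.V) (v : ℝ → H) : Prop where
  cont_pos : Continuous u
  cont_vel : Continuous v
  cont_force : Continuous f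
  deriv_pos : ∀ n t, HasDerivAt (fun s => A.coord n (A.incl (u s))) (A.coord n (v t)) t
  deriv_vel : ∀ n t, HasDerivAt (fun s => A.coord n (v s))
    (-(A.μ n * A.coord n (A.incl (u t))) - k * A.coord n (v t) + A.coord n (f t)) t

section linSol

variable {A} {k : ℝ} (hk : 0 ≤ k) (U₀ : A.V × H) {f : ℝ → H}

@[simp] theorem linSol_zero (f : ℝ → H) : A.linSol hk U₀ f 0 = U₀ := by
  simp [linSol, waveGroup_zero]

theorem continuous_waveGroup_neg_force (hf : Continuous f) :
    Continuous fun s : ℝ => A.waveGroup hk (-s) ((0 : A.V), f s) :=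
  A.continuous_waveGroup_comp hk continuous_neg (continuous_const.prodMk hf)

theorem continuous_linSol (hf : Continuous f) : Continuous (A.linSol hk U₀ f) :=
  A.continuous_waveGroup_comp hk continuous_id
    (continuous_const.add (intervalIntegral.continuous_primitive
      (fun a b => (continuous_waveGroup_neg_force hk hf).intervalIntegrable a b) 0))

theorem linSol_eq (hf : Continuous f) (t : ℝ) : A.linSol hk U₀ f t =
    A.waveGroup hk t U₀ + ∫ s in (0 : ℝ)..t, A.waveGroup hk (t - s) (0, f s) := by
  rw [linSol, map_add, ← ContinuousLinearMap.intervalIntegral_comp_comm _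
    ((continuous_waveGroup_neg_force hk hf).intervalIntegrable 0 t)]
  simp only [sub_eq_add_neg, waveGroup_add, ContinuousLinearMap.comp_apply]

theorem hasDerivAt_mode_linSol (hf : Continuous f) (n : ℕ) (t : ℝ) :
    HasDerivAt (fun s => A.mode n (A.linSol hk U₀ f s))
      (A.modeGen k n (A.mode n (A.linSol hk U₀ f t)) + A.mode n (0, f t)) t := by
  have hI := (continuous_waveGroup_neg_force (A := A) hk hf).integral_hasStrictDerivAt 0 t |>.hasDerivAt
  have h1 := (A.mode n).hasFDerivAt.comp_hasDerivAt t (hI.const_add U₀)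
  have h2 := (A.hasDerivAt_modeProp k n t).clm_apply h1
  refine (h2.congr_deriv ?_).congr_of_eventuallyEq ?_
  · simp only [linSol, mode_waveGroup, Function.comp_apply]
    congr 1
    rw [← mul_apply_eq_comp, ← modeProp_add, add_neg_cancel, modeProp_zero, one_apply_eq_self]
  · exact Eventually.of_forall fun s => by simp [linSol]

theorem isModalSolution_linSol (hf : Continuous f) : A.IsModalSolution k f
    (fun t => (A.linSol hk U₀ f t).1) (fun t => (A.linSol hk U₀ f t).2) where
  cont_pos := (continuous_linSol hk U₀ hf).fst
  cont_vel := (continuous_linSol hk U₀ hf).snd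
  cont_force := hf
  deriv_pos n t := by
    have h := Complex.reCLM.hasFDerivAt.comp_hasDerivAt t (hasDerivAt_mode_linSol hk U₀ hf n t)
    have h1 := h.const_mul (A.freq n)⁻¹
    refine (h1.congr_deriv ?_).congr_of_eventuallyEq (Eventually.of_forall fun s => ?_)
    · simp [(A.freq_pos n).ne']
    · simp [(A.freq_pos n).ne']
  deriv_vel n t := by
    have h := Complex.imCLM.hasFDerivAt.comp_hasDerivAt t (hasDerivAt_mode_linSol hk U₀ hf n t)
    refine (h.congr_deriv ?_).congr_of_eventuallyEq (Eventually.of_forall fun s => ?_)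
    · simp [← A.freq_sq]; ring
    · simp

end linSol

/-! ### Galerkin projections -/

theorem coord_e (m n : ℕ) : A.coord m (A.e n) = if m = n then 1 else 0 := by
  rw [coord_apply]
  exact orthonormal_iff_ite.1 A.e.orthonormal m n

theorem exists_incl_eq_e (n : ℕ) : ∃ u : A.V, A.incl u = A.e n :=
  A.exists_incl_eq <| summable_of_ne_finset_zero (s := {n}) fun m hm => by
    simp [coord_e, Finset.notMem_singleton.1 hm]

/-- The eigenvector `e n` as an element of `D(A^{1/2})`. -/
def eV (n : ℕ) : A.V := (A.exists_incl_eq_e n).choose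

theorem incl_eV (n : ℕ) : A.incl (A.eV n) = A.e n := (A.exists_incl_eq_e n).choose_spec

/-- The orthogonal projection onto the span of the first `N` eigenvectors, with values in
`D(A^{1/2})`. -/
def proj (N : ℕ) (x : H) : A.V := ∑ n ∈ Finset.range N, A.coord n x • A.eV n

theorem continuous_proj (N : ℕ) : Continuous (A.proj N) :=
  continuous_finsetSum _ fun n _ => (A.coord n).continuous.smul continuous_const

theorem coord_incl_proj (N m : ℕ) (x : H) :
    A.coord m (A.incl (A.proj N x)) = if m < N then A.coord m x else 0 := by
  simp [proj, incl_eV, coord_e]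

theorem norm_incl_proj_le (N : ℕ) (x : H) : ‖A.incl (A.proj N x)‖ ≤ ‖x‖ := by
  refine (sq_le_sq₀ (norm_nonneg _) (norm_nonneg _)).1
    (hasSum_le (fun n => ?_) (A.hasSum_coord_sq _) (A.hasSum_coord_sq x))
  rw [coord_incl_proj]
  split_ifs
  · exact le_rfl
  · simpa using sq_nonneg _

theorem norm_proj_incl_le (N : ℕ) (u : A.V) : ‖A.proj N (A.incl u)‖ ≤ ‖u‖ := by
  refine (sq_le_sq₀ (norm_nonneg _) (norm_nonneg _)).1
    (hasSum_le (fun n => ?_) (A.hasSum_freq_mul_coord_sq _) (A.hasSum_freq_mul_coord_sq u))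
  rw [coord_incl_proj]
  split_ifs
  · exact le_rfl
  · simpa using sq_nonneg _

theorem tendsto_proj (U : A.V × H) :
    Tendsto (fun N => (A.proj N (A.incl U.1), A.incl (A.proj N U.2))) atTop (𝓝 U) := by
  have hm : ∀ N n, A.mode n (A.proj N (A.incl U.1), A.incl (A.proj N U.2))
      = if n < N then A.mode n U else 0 := by
    intro N n
    apply Complex.ext <;> simp only [mode_re, mode_im, coord_incl_proj] <;> split_ifs <;> simp
  refine A.tendsto_of_mode (b := fun n => ‖A.mode n U‖) (A.hasSum_norm_mode_sq U).summable
    (fun n => ?_) (Eventually.of_forall fun N n => ?_)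
  · refine tendsto_const_nhds.congr' ?_
    filter_upwards [eventually_gt_atTop n] with N hN
    rw [hm, if_pos hN]
  · rw [hm]
    split_ifs <;> simp

theorem tendsto_proj_incl (u : A.V) : Tendsto (fun N => A.proj N (A.incl u)) atTop (𝓝 u) :=
  (A.tendsto_proj (u, 0)).fst_nhds

theorem tendsto_incl_proj (x : H) : Tendsto (fun N => A.incl (A.proj N x)) atTop (𝓝 x) :=
  (A.tendsto_proj (0, x)).snd_nhds

theorem abs_sum_coord_mul_le (N : ℕ) (x y : H) :
    |∑ n ∈ Finset.range N, A.coord n x * A.coord n y| ≤ (‖x‖ ^ 2 + ‖y‖ ^ 2) / 2 := by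
  have hx := sum_le_hasSum (Finset.range N) (fun n _ => sq_nonneg _) (A.hasSum_coord_sq x)
  have hy := sum_le_hasSum (Finset.range N) (fun n _ => sq_nonneg _) (A.hasSum_coord_sq y)
  calc |∑ n ∈ Finset.range N, A.coord n x * A.coord n y|
      ≤ ∑ n ∈ Finset.range N, |A.coord n x * A.coord n y| := Finset.abs_sum_le_sum_abs _ _
    _ ≤ ∑ n ∈ Finset.range N, (A.coord n x ^ 2 + A.coord n y ^ 2) / 2 := by
        refine Finset.sum_le_sum fun n _ => abs_le.2 ⟨?_, ?_⟩
        · nlinarith [sq_nonneg (A.coord n x + A.coord n y)]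
        · nlinarith [sq_nonneg (A.coord n x - A.coord n y)]
    _ ≤ (‖x‖ ^ 2 + ‖y‖ ^ 2) / 2 := by
        rw [← Finset.sum_div, Finset.sum_add_distrib]
        linarith

end PositiveDiscreteOperator

/-! ### Energy identities -/

/-- A pointwise limit of `C¹` functions whose derivatives converge pointwise and boundedly to a
continuous function is differentiable, with the expected derivative. -/
theorem hasDerivAt_of_tendsto_of_bounded {E : Type*} [NormedAddCommGroup E] [NormedSpace ℝ E]
    [CompleteSpace E] {g g' : ℕ → ℝ → E} {G G' : ℝ → E}
    (hd : ∀ N t, HasDerivAt (g N) (g' N t) t) (hc : ∀ N, Continuous (g' N))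
    (hG' : Continuous G') (hbd : ∀ a : ℝ, ∃ K : ℝ, ∀ N, ∀ s ∈ uIcc 0 a, ‖g' N s‖ ≤ K)
    (hlim : ∀ t, Tendsto (fun N => g N t) atTop (𝓝 (G t)))
    (hlim' : ∀ t, Tendsto (fun N => g' N t) atTop (𝓝 (G' t))) (t : ℝ) :
    HasDerivAt G (G' t) t := by
  have key : ∀ a, G a = G 0 + ∫ s in (0 : ℝ)..a, G' s := by
    intro a
    obtain ⟨K, hK⟩ := hbd a
    have h1 : Tendsto (fun N => ∫ s in (0 : ℝ)..a, g' N s) atTop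
        (𝓝 (∫ s in (0 : ℝ)..a, G' s)) := by
      refine intervalIntegral.tendsto_integral_filter_of_dominated_convergence (fun _ => K)
        (Eventually.of_forall fun N => (hc N).aestronglyMeasurable)
        (Eventually.of_forall fun N => Eventually.of_forall fun s hs =>
          hK N s (uIoc_subset_uIcc hs)) intervalIntegrable_const
        (Eventually.of_forall fun s _ => hlim' s)
    have h2 : ∀ N, ∫ s in (0 : ℝ)..a, g' N s = g N a - g N 0 := fun N =>
      intervalIntegral.integral_eq_sub_of_hasDerivAt (fun s _ => hd N s)
        ((hc N).intervalIntegrable 0 a)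
    simp only [h2] at h1
    rw [← tendsto_nhds_unique ((hlim a).sub (hlim 0)) h1]
    abel
  have h3 := (hG'.integral_hasStrictDerivAt 0 t).hasDerivAt.const_add (G 0)
  exact h3.congr_of_eventuallyEq (Eventually.of_forall key)

theorem exists_bound_uIcc {f : ℝ → ℝ} (hf : Continuous f) (a : ℝ) :
    ∃ K : ℝ, ∀ s ∈ uIcc 0 a, f s ≤ K := by
  obtain ⟨K, hK⟩ := (isCompact_uIcc (a := (0 : ℝ)) (b := a)).bddAbove_image hf.continuousOn
  exact ⟨K, fun s hs => hK (mem_image_of_mem f hs)⟩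

namespace PositiveDiscreteOperator.IsModalSolution

variable {A : PositiveDiscreteOperator H} {k : ℝ} {f : ℝ → H} {u : ℝ → A.V} {v : ℝ → H}

theorem hasDerivAt_proj (hU : A.IsModalSolution k f u v) (N : ℕ) (t : ℝ) :
    HasDerivAt (fun s => A.proj N (A.incl (u s))) (A.proj N (v t)) t :=
  HasDerivAt.fun_sum fun n _ => (hU.deriv_pos n t).smul_const (A.eV n)

/-- In `H` the velocity is the derivative of the position. -/
theorem hasDerivAt_incl (hU : A.IsModalSolution k f u v) (t : ℝ) :
    HasDerivAt (fun s => A.incl (u s)) (v t) t := by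
  refine hasDerivAt_of_tendsto_of_bounded
    (g := fun N s => A.incl (A.proj N (A.incl (u s)))) (g' := fun N s => A.incl (A.proj N (v s)))
    (fun N s => A.inclL.hasFDerivAt.comp_hasDerivAt s (hU.hasDerivAt_proj N s))
    (fun N => A.continuous_incl.comp ((A.continuous_proj N).comp hU.cont_vel)) hU.cont_vel
    (fun a => ?_) (fun s => A.tendsto_incl_proj _) (fun s => A.tendsto_incl_proj _) t
  obtain ⟨K, hK⟩ := exists_bound_uIcc hU.cont_vel.norm a
  exact ⟨K, fun N s hs => (A.norm_incl_proj_le N _).trans (hK s hs)⟩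

/-- The energy identity of the linear equation. -/
theorem hasDerivAt_energy (hU : A.IsModalSolution k f u v) (t : ℝ) :
    HasDerivAt (fun s => ‖u s‖ ^ 2 + ‖v s‖ ^ 2) (2 * inner ℝ (v t) (f t - k • v t)) t := by
  have hw : Continuous fun s => f s - k • v s :=
    hU.cont_force.sub (hU.cont_vel.const_smul k)
  refine hasDerivAt_of_tendsto_of_bounded
    (g := fun N s => ∑ n ∈ Finset.range N,
      ((A.freq n * A.coord n (A.incl (u s))) ^ 2 + A.coord n (v s) ^ 2))
    (g' := fun N s => 2 * ∑ n ∈ Finset.range N, A.coord n (v s) * A.coord n (f s - k • v s))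
    (fun N s => ?_) (fun N => ?_) ((hU.cont_vel.inner hw).const_mul 2)
    (fun a => ?_) (fun s => ?_) (fun s => ?_) t
  · rw [Finset.mul_sum]
    refine HasDerivAt.fun_sum fun n _ => ?_
    refine ((((hU.deriv_pos n s).const_mul (A.freq n)).fun_pow 2).fun_add
      ((hU.deriv_vel n s).fun_pow 2)).congr_deriv ?_
    simp only [map_sub, map_smul, smul_eq_mul, ← A.freq_sq]
    ring
  · exact (continuous_finsetSum _ fun n _ => ((A.coord n).continuous.comp hU.cont_vel).mul
      ((A.coord n).continuous.comp hw)).const_mul 2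
  · obtain ⟨K, hK⟩ := exists_bound_uIcc ((hU.cont_vel.norm.pow 2).add (hw.norm.pow 2)) a
    simp only [Pi.add_apply, Pi.pow_apply] at hK
    refine ⟨K, fun N s hs => le_trans ?_ (hK s hs)⟩
    rw [Real.norm_eq_abs, abs_mul, abs_two]
    linarith [A.abs_sum_coord_mul_le N (v s) (f s - k • v s)]
  · exact ((A.hasSum_freq_mul_coord_sq (u s)).add (A.hasSum_coord_sq (v s))).tendsto_sum_nat
  · exact (A.hasSum_coord_mul _ _).tendsto_sum_nat.const_mul 2

/-- The virial identity, from testing the equation with `u`. -/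
theorem hasDerivAt_inner (hU : A.IsModalSolution k f u v) (t : ℝ) :
    HasDerivAt (fun s => inner ℝ (A.incl (u s)) (v s))
      (‖v t‖ ^ 2 - ‖u t‖ ^ 2 + inner ℝ (A.incl (u t)) (f t - k • v t)) t := by
  have hw : Continuous fun s => f s - k • v s :=
    hU.cont_force.sub (hU.cont_vel.const_smul k)
  have hi : Continuous fun s => A.incl (u s) := A.continuous_incl.comp hU.cont_pos
  have hs : Continuous fun s => A.sqrtA (u s) := A.sqrtEquiv.continuous.comp hU.cont_pos
  have hcn : ∀ (n : ℕ) {x : ℝ → H}, Continuous x → Continuous fun s => A.coord n (x s) :=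
    fun n x hx => (A.coord n).continuous.comp hx
  refine hasDerivAt_of_tendsto_of_bounded
    (g := fun N s => ∑ n ∈ Finset.range N, A.coord n (A.incl (u s)) * A.coord n (v s))
    (g' := fun N s => (∑ n ∈ Finset.range N, A.coord n (v s) * A.coord n (v s))
      - (∑ n ∈ Finset.range N, A.coord n (A.sqrtA (u s)) * A.coord n (A.sqrtA (u s)))
      + ∑ n ∈ Finset.range N, A.coord n (A.incl (u s)) * A.coord n (f s - k • v s))
    (fun N s => ?_) (fun N => ?_)
    (((hU.cont_vel.norm.pow 2).sub (hU.cont_pos.norm.pow 2)).add (hi.inner hw))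
    (fun a => ?_) (fun s => (A.hasSum_coord_mul _ _).tendsto_sum_nat) (fun s => ?_) t
  · rw [← Finset.sum_sub_distrib, ← Finset.sum_add_distrib]
    refine HasDerivAt.fun_sum fun n _ => ?_
    refine ((hU.deriv_pos n s).mul (hU.deriv_vel n s)).congr_deriv ?_
    simp only [map_sub, map_smul, smul_eq_mul, ← A.freq_sq, coord_sqrtA]
    ring
  · refine ((continuous_finsetSum _ fun n _ => ?_).sub
      (continuous_finsetSum _ fun n _ => ?_)).add (continuous_finsetSum _ fun n _ => ?_)
    · exact (hcn n hU.cont_vel).mul (hcn n hU.cont_vel)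
    · exact (hcn n hs).mul (hcn n hs)
    · exact (hcn n hi).mul (hcn n hw)
  · obtain ⟨K, hK⟩ := exists_bound_uIcc ((((hU.cont_vel.norm.pow 2)).add (hs.norm.pow 2)).add
      ((hi.norm.pow 2).add (hw.norm.pow 2))) a
    simp only [Pi.add_apply, Pi.pow_apply] at hK
    refine ⟨K, fun N s hs => le_trans ?_ (hK s hs)⟩
    have h1 := A.abs_sum_coord_mul_le N (v s) (v s)
    have h2 := A.abs_sum_coord_mul_le N (A.sqrtA (u s)) (A.sqrtA (u s))
    have h3 := A.abs_sum_coord_mul_le N (A.incl (u s)) (f s - k • v s)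
    have h4 := sq_nonneg ‖A.incl (u s)‖
    have h5 := sq_nonneg ‖f s - k • v s‖
    rw [abs_le] at h1 h2 h3
    rw [Real.norm_eq_abs, abs_le]
    constructor <;> linarith
  · have h1 := (A.hasSum_coord_mul (v s) (v s)).tendsto_sum_nat
    have h2 := (A.hasSum_coord_mul (A.sqrtA (u s)) (A.sqrtA (u s))).tendsto_sum_nat
    rw [real_inner_self_eq_norm_sq] at h1 h2
    exact (h1.sub h2).add (A.hasSum_coord_mul _ _).tendsto_sum_nat

/-- The chain rule for a functional on `D(A^{1/2})` whose derivative is represented by a map with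
values in `H`; it holds although `u` is differentiable in `H` only. -/
theorem hasDerivAt_potential (hU : A.IsModalSolution k f u v) {P : A.V → ℝ} {K : A.V → H}
    (hP : ContDiff ℝ 1 P) (hPK : ∀ x w, fderiv ℝ P x w = inner ℝ (K x) (A.incl w))
    (hK : Continuous K) (hKb : ∀ r : ℝ, ∃ C : ℝ, ∀ x, ‖x‖ ≤ r → ‖K x‖ ≤ C) (t : ℝ) :
    HasDerivAt (fun s => P (u s)) (inner ℝ (K (u t)) (v t)) t := by
  have hpc : ∀ N, Continuous fun s => A.proj N (A.incl (u s)) := fun N =>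
    (A.continuous_proj N).comp (A.continuous_incl.comp hU.cont_pos)
  refine hasDerivAt_of_tendsto_of_bounded
    (g := fun N s => P (A.proj N (A.incl (u s))))
    (g' := fun N s => inner ℝ (K (A.proj N (A.incl (u s)))) (A.incl (A.proj N (v s))))
    (fun N s => ?_) (fun N => ?_) ((hK.comp hU.cont_pos).inner hU.cont_vel)
    (fun a => ?_) (fun s => ?_) (fun s => ?_) t
  · rw [← hPK]
    exact ((hP.differentiable one_ne_zero) _).hasFDerivAt.comp_hasDerivAt s (hU.hasDerivAt_proj N s)
  · exact (hK.comp (hpc N)).inner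
      (A.continuous_incl.comp ((A.continuous_proj N).comp hU.cont_vel))
  · obtain ⟨r, hr⟩ := exists_bound_uIcc hU.cont_pos.norm a
    obtain ⟨r', hr'⟩ := exists_bound_uIcc hU.cont_vel.norm a
    obtain ⟨C, hC⟩ := hKb r
    refine ⟨C * r', fun N s hs => (norm_inner_le_norm _ _).trans ?_⟩
    have h1 := hC _ ((A.norm_proj_incl_le N (u s)).trans (hr s hs))
    exact mul_le_mul h1 ((A.norm_incl_proj_le N _).trans (hr' s hs)) (norm_nonneg _)
      ((norm_nonneg _).trans h1)
  · exact (hP.continuous.tendsto _).comp (A.tendsto_proj_incl _)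
  · exact ((hK.tendsto _).comp (A.tendsto_proj_incl _)).inner (A.tendsto_incl_proj _)

end PositiveDiscreteOperator.IsModalSolution

/-! ### Trajectories of the forced linear equation -/

section Trajectory

variable {A : PositiveDiscreteOperator H} {h : ℝ≥0}

/-- The right end point `0` of the delay interval. -/
def zeroPt (h : ℝ≥0) : DelayInterval h := ⟨0, neg_nonpos.2 h.coe_nonneg, le_rfl⟩

theorem norm_le_wNorm (φ : phaseSpace A h) : ‖φ‖ ≤ wNorm φ :=
  max_le (le_add_of_nonneg_right (norm_nonneg _)) (le_add_of_nonneg_left (norm_nonneg _))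

theorem wNorm_le_two_mul (φ : phaseSpace A h) : wNorm φ ≤ 2 * ‖φ‖ := by
  have h1 : ‖φ.1.1‖ ≤ ‖φ‖ := norm_fst_le φ.1
  have h2 : ‖φ.1.2‖ ≤ ‖φ‖ := norm_snd_le φ.1
  rw [wNorm]
  linarith

theorem norm_phaseSpace_le {φ : phaseSpace A h} {c : ℝ} (hc : 0 ≤ c)
    (h1 : ∀ θ, ‖φ.1.1 θ‖ ≤ c) (h2 : ∀ θ, ‖φ.1.2 θ‖ ≤ c) : ‖φ‖ ≤ c :=
  max_le ((ContinuousMap.norm_le _ hc).2 h1) ((ContinuousMap.norm_le _ hc).2 h2)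

theorem norm_pos_apply_le (φ : phaseSpace A h) (θ : DelayInterval h) : ‖φ.1.1 θ‖ ≤ ‖φ‖ :=
  (φ.1.1.norm_coe_le_norm θ).trans (norm_fst_le φ.1)

theorem norm_vel_apply_le (φ : phaseSpace A h) (θ : DelayInterval h) : ‖φ.1.2 θ‖ ≤ ‖φ‖ :=
  (φ.1.2.norm_coe_le_norm θ).trans (norm_snd_le φ.1)

namespace Trajectory

theorem continuous_segment (u : Trajectory A h) : Continuous u.segment := by
  have hc : Continuous fun p : ℝ≥0 × DelayInterval h => shiftPt p.1 p.2 :=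
    Continuous.subtype_mk (by fun_prop) _
  refine Continuous.subtype_mk (Continuous.prodMk ?_ ?_) _
  · exact ContinuousMap.continuous_of_continuous_uncurry _ (u.pos.continuous.comp hc)
  · exact ContinuousMap.continuous_of_continuous_uncurry _ (u.vel.continuous.comp hc)

theorem state_eq_segment (u : Trajectory A h) (t : ℝ≥0) :
    u.state t = ((u.segment t).1.1 (zeroPt h), (u.segment t).1.2 (zeroPt h)) := by
  have hx : shiftPt t (zeroPt h)
      = ⟨t, (neg_nonpos.2 h.coe_nonneg).trans t.coe_nonneg⟩ := Subtype.ext (add_zero _)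
  rw [state, segment]
  simp only [ContinuousMap.comp_apply, ContinuousMap.coe_mk, hx]

theorem ext_of_state {u u' : Trajectory A h} (h0 : u.segment 0 = u'.segment 0)
    (hs : ∀ t, u.state t = u'.state t) : u = u' := by
  have key : ∀ x : Ici (-(h : ℝ)), u.pos x = u'.pos x ∧ u.vel x = u'.vel x := by
    intro x
    rcases le_total (x : ℝ) 0 with hx | hx
    · have hx' : shiftPt 0 ⟨(x : ℝ), x.2, hx⟩ = x := Subtype.ext (zero_add _)
      rw [← hx']
      exact ⟨congrArg (fun φ : phaseSpace A h => φ.1.1 ⟨(x : ℝ), x.2, hx⟩) h0,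
        congrArg (fun φ : phaseSpace A h => φ.1.2 ⟨(x : ℝ), x.2, hx⟩) h0⟩
    · exact ⟨congrArg Prod.fst (hs ⟨x, hx⟩), congrArg Prod.snd (hs ⟨x, hx⟩)⟩
  exact Trajectory.ext (ContinuousMap.ext fun x => (key x).1)
    (ContinuousMap.ext fun x => (key x).2)

theorem ext_of_segment {u u' : Trajectory A h} (hs : ∀ t, u.segment t = u'.segment t) :
    u = u' :=
  ext_of_state (hs 0) fun t => by rw [state_eq_segment, state_eq_segment, hs]

end Trajectory

variable {k : ℝ} (hk : 0 ≤ k) (φ : phaseSpace A h) {f g : ℝ → H}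

/-- The state `(φ(0), φ̇(0))`. -/
def initState (φ : phaseSpace A h) : A.V × H := (φ.1.1 (zeroPt h), φ.1.2 (zeroPt h))

/-- The history `φ` on `[-h, 0]`, continued by the solution of the forced linear equation. -/
def glue (f : ℝ → H) (t : ℝ) : A.V × H :=
  if t ≤ 0 then (IccExtend (neg_nonpos.2 h.coe_nonneg) φ.1.1 t,
    IccExtend (neg_nonpos.2 h.coe_nonneg) φ.1.2 t)
  else A.linSol hk (initState φ) f t

theorem glue_of_nonneg {t : ℝ} (ht : 0 ≤ t) :
    glue hk φ f t = A.linSol hk (initState φ) f t := by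
  rcases ht.eq_or_lt with rfl | ht
  · have h0 : (0 : ℝ) ∈ Icc (-(h : ℝ)) 0 := ⟨neg_nonpos.2 h.coe_nonneg, le_rfl⟩
    rw [glue, if_pos le_rfl, IccExtend_of_mem _ _ h0, IccExtend_of_mem _ _ h0,
      PositiveDiscreteOperator.linSol_zero]
    rfl
  · rw [glue, if_neg ht.not_ge]

theorem glue_of_mem {t : ℝ} (ht : t ∈ Icc (-(h : ℝ)) 0) :
    glue hk φ f t = (φ.1.1 ⟨t, ht⟩, φ.1.2 ⟨t, ht⟩) := by
  rw [glue, if_pos ht.2, IccExtend_of_mem _ _ ht, IccExtend_of_mem _ _ ht]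

theorem continuous_glue (hf : Continuous f) : Continuous (glue hk φ f) := by
  refine Continuous.if_le ?_ (PositiveDiscreteOperator.continuous_linSol hk _ hf) continuous_id
    continuous_const fun t ht => ?_
  · exact φ.1.1.continuous.Icc_extend'.prodMk φ.1.2.continuous.Icc_extend'
  · have h1 := glue_of_nonneg hk φ (f := f) ht.ge
    rwa [glue, if_pos ht.le] at h1

theorem hasDerivWithinAt_glue (hf : Continuous f) {t : ℝ} (ht : -(h : ℝ) ≤ t) :
    HasDerivWithinAt (fun s => A.incl (glue hk φ f s).1) (glue hk φ f t).2 (Ici (-(h : ℝ))) t := by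
  rw [← Icc_union_Ici_eq_Ici (neg_nonpos.2 h.coe_nonneg)]
  refine HasDerivWithinAt.union ?_ ?_
  · by_cases h0 : t ≤ 0
    · have h1 := φ.2 ⟨t, ht, h0⟩
      rw [glue_of_mem hk φ ⟨ht, h0⟩]
      refine h1.congr_of_mem (fun s hs => ?_) ⟨ht, h0⟩
      rw [glue_of_mem hk φ hs, IccExtend_of_mem _ _ hs]
    · refine HasFDerivWithinAt.of_notMem_closure ?_
      rw [closure_Icc]
      exact fun hm => h0 hm.2
  · by_cases h0 : 0 ≤ t
    · have h1 := ((PositiveDiscreteOperator.isModalSolution_linSol hk (initState φ)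
        hf).hasDerivAt_incl t).hasDerivWithinAt (s := Ici 0)
      rw [glue_of_nonneg hk φ h0]
      refine h1.congr_of_mem (fun s hs => ?_) h0
      rw [glue_of_nonneg hk φ hs]
    · refine HasFDerivWithinAt.of_notMem_closure ?_
      rw [closure_Ici]
      exact h0

/-- The trajectory with history `φ` that solves the linear equation with forcing term `f`. -/
def forcedTraj (hf : Continuous f) : Trajectory A h where
  pos := ⟨fun t => (glue hk φ f t).1, (continuous_glue hk φ hf).fst.comp continuous_subtype_val⟩
  vel := ⟨fun t => (glue hk φ f t).2, (continuous_glue hk φ hf).snd.comp continuous_subtype_val⟩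
  hasDeriv t := by
    refine (hasDerivWithinAt_glue hk φ hf t.2).congr_of_mem (fun s hs => ?_) t.2
    rw [IciExtend_of_mem _ hs]
    rfl

theorem forcedTraj_segment_pos (hf : Continuous f) (t : ℝ≥0) (θ : DelayInterval h) :
    ((forcedTraj hk φ hf).segment t).1.1 θ = (glue hk φ f (t + θ)).1 := rfl

theorem forcedTraj_segment_vel (hf : Continuous f) (t : ℝ≥0) (θ : DelayInterval h) :
    ((forcedTraj hk φ hf).segment t).1.2 θ = (glue hk φ f (t + θ)).2 := rfl

theorem forcedTraj_state (hf : Continuous f) (t : ℝ≥0) :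
    (forcedTraj hk φ hf).state t = A.linSol hk (initState φ) f t := by
  rw [← glue_of_nonneg hk φ t.coe_nonneg]
  rfl

theorem forcedTraj_segment_zero (hf : Continuous f) : (forcedTraj hk φ hf).segment 0 = φ := by
  refine Subtype.ext (Prod.ext (ContinuousMap.ext fun θ => ?_) (ContinuousMap.ext fun θ => ?_))
  · rw [forcedTraj_segment_pos, NNReal.coe_zero, zero_add, glue_of_mem hk φ θ.2]
  · rw [forcedTraj_segment_vel, NNReal.coe_zero, zero_add, glue_of_mem hk φ θ.2]

theorem norm_linSol_sub_le (U₀ : A.V × H) (hf : Continuous f) (hg : Continuous g) {lam K t : ℝ}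
    (hlam : 0 < lam) (hK : 0 ≤ K) (ht : 0 ≤ t)
    (hfg : ∀ s ∈ Icc 0 t, ‖f s - g s‖ ≤ K * Real.exp (lam * s)) :
    ‖A.linSol hk U₀ f t - A.linSol hk U₀ g t‖ ≤ 2 * K / lam * Real.exp (lam * t) := by
  have hci : ∀ {f : ℝ → H}, Continuous f →
      IntervalIntegrable (fun s => A.waveGroup hk (t - s) ((0 : A.V), f s)) volume 0 t :=
    fun hf => (A.continuous_waveGroup_comp hk (continuous_const.sub continuous_id)
      (continuous_const.prodMk hf)).intervalIntegrable _ _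
  have he : ∀ s, HasDerivAt (fun s => 2 * K / lam * Real.exp (lam * s))
      (2 * K * Real.exp (lam * s)) s := fun s => by
    refine (((hasDerivAt_id s).const_mul lam).exp.const_mul (2 * K / lam)).congr_deriv ?_
    simp only [id_eq]
    field_simp
  have hcont : Continuous fun s => 2 * K * Real.exp (lam * s) := by fun_prop
  have hint : ∫ s in (0 : ℝ)..t, 2 * K * Real.exp (lam * s)
      = 2 * K / lam * Real.exp (lam * t) - 2 * K / lam * Real.exp (lam * 0) :=
    intervalIntegral.integral_eq_sub_of_hasDerivAt (fun s _ => he s)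
      (hcont.intervalIntegrable _ _)
  rw [PositiveDiscreteOperator.linSol_eq hk U₀ hf, PositiveDiscreteOperator.linSol_eq hk U₀ hg,
    add_sub_add_left_eq_sub, ← intervalIntegral.integral_sub (hci hf) (hci hg)]
  refine (intervalIntegral.norm_integral_le_of_norm_le ht
    (Eventually.of_forall fun s hs => ?_) (hcont.intervalIntegrable 0 t)).trans ?_
  · rw [← map_sub, Prod.mk_sub_mk, sub_zero]
    refine (A.norm_waveGroup_le hk (sub_nonneg.2 hs.2) _).trans ?_
    rw [mul_assoc, Prod.norm_mk, norm_zero, max_eq_right (norm_nonneg _)]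
    exact mul_le_mul_of_nonneg_left (hfg s ⟨hs.1.le, hs.2⟩) zero_le_two
  · rw [hint, sub_le_self_iff]
    positivity

/-- Lipschitz dependence of the segments on the forcing term, in an exponentially weighted
norm. -/
theorem norm_segment_sub_le (hf : Continuous f) (hg : Continuous g) {lam K : ℝ}
    (hlam : 0 < lam) (hK : 0 ≤ K) (t : ℝ≥0)
    (hfg : ∀ s ∈ Icc 0 (t : ℝ), ‖f s - g s‖ ≤ K * Real.exp (lam * s)) :
    ‖(forcedTraj hk φ hf).segment t - (forcedTraj hk φ hg).segment t‖
      ≤ 2 * K / lam * Real.exp (lam * t) := by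
  have hnn : 0 ≤ 2 * K / lam * Real.exp (lam * t) := by positivity
  have key : ∀ θ : DelayInterval h, ‖glue hk φ f (t + θ) - glue hk φ g (t + θ)‖
      ≤ 2 * K / lam * Real.exp (lam * t) := by
    intro θ
    rcases le_total ((t : ℝ) + θ) 0 with h0 | h0
    · have hm : (t : ℝ) + θ ∈ Icc (-(h : ℝ)) 0 :=
        ⟨by linarith [θ.2.1, t.coe_nonneg], h0⟩
      rwa [glue_of_mem hk φ hm, glue_of_mem hk φ hm, sub_self, norm_zero]
    · rw [glue_of_nonneg hk φ h0, glue_of_nonneg hk φ h0]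
      refine (norm_linSol_sub_le hk _ hf hg hlam hK h0 fun s hs =>
        hfg s ⟨hs.1, by linarith [hs.2, θ.2.2]⟩).trans ?_
      gcongr
      linarith [θ.2.2]
  refine norm_phaseSpace_le hnn (fun θ => ?_) (fun θ => ?_)
  · exact (norm_fst_le (glue hk φ f (t + θ) - glue hk φ g (t + θ))).trans (key θ)
  · exact (norm_snd_le (glue hk φ f (t + θ) - glue hk φ g (t + θ))).trans (key θ)

/-! ### Mild solutions as fixed points -/

/-- The total force `-(F(φ(0)) + M(φ))`. -/
def force (F : A.V → H) (M : phaseSpace A h → H) (φ : phaseSpace A h) : H :=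
  -(F (φ.1.1 (zeroPt h)) + M φ)

theorem force_segment (F : A.V → H) (M : phaseSpace A h → H) (u : Trajectory A h) (t : ℝ≥0) :
    force F M (u.segment t) = -(F (u.state t).1 + M (u.segment t)) := by
  rw [Trajectory.state_eq_segment]
  rfl

theorem IsMildSolution.eq_forcedTraj {F : A.V → H} {M : phaseSpace A h → H}
    {u : Trajectory A h} (hu : IsMildSolution (A.waveGroup hk) F M φ u)
    (hc : Continuous fun s : ℝ => force F M (u.segment s.toNNReal)) :
    u = forcedTraj hk φ hc := by
  refine Trajectory.ext_of_state ?_ fun t => ?_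
  · rw [hu.init, forcedTraj_segment_zero]
  · rw [forcedTraj_state, PositiveDiscreteOperator.linSol_eq hk _ hc, hu.mild t]
    simp only [force_segment]
    congr 2
    rw [Trajectory.state_eq_segment, hu.init]
    rfl

theorem isMildSolution_forcedTraj {F : A.V → H} {M : phaseSpace A h → H} (hf : Continuous f)
    (hfix : ∀ t : ℝ≥0, f t = force F M ((forcedTraj hk φ hf).segment t)) :
    IsMildSolution (A.waveGroup hk) F M φ (forcedTraj hk φ hf) where
  init := forcedTraj_segment_zero hk φ hf
  mild t := by
    rw [forcedTraj_state, PositiveDiscreteOperator.linSol_eq hk _ hf, forcedTraj_state,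
      NNReal.coe_zero, PositiveDiscreteOperator.linSol_zero]
    congr 1
    refine intervalIntegral.integral_congr fun s hs => ?_
    rw [uIcc_of_le t.coe_nonneg] at hs
    have h1 := hfix s.toNNReal
    rw [Real.coe_toNNReal s hs.1, force_segment] at h1
    simp only [h1]

/-- A globally Lipschitz and bounded force has a solution, by the contraction principle for the
forcing term in an exponentially weighted space. -/
theorem exists_forcedTraj_of_lipschitz {N : phaseSpace A h → H} {L B : ℝ} (hL : 0 < L)
    (hN : ∀ x y, ‖N x - N y‖ ≤ L * ‖x - y‖) (hB : ∀ x, ‖N x‖ ≤ B) :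
    ∃ (f : ℝ → H) (hf : Continuous f),
      ∀ t : ℝ≥0, f t = N ((forcedTraj hk φ hf).segment t) := by
  have hNc : Continuous N :=
    (LipschitzWith.of_dist_le_mul (K := ⟨L, hL.le⟩) fun x y => by
      rw [dist_eq_norm, dist_eq_norm]
      exact hN x y).continuous
  -- the weight `exp (4 L t)` makes the contraction constant `2 L / (4 L) = 1 / 2`
  let w : BoundedContinuousFunction ℝ≥0 H → ℝ → H := fun b s =>
    Real.exp (4 * L * s.toNNReal) • b s.toNNReal
  have hw : ∀ b, Continuous (w b) := fun b => by
    have h1 : Continuous fun s : ℝ => ((s.toNNReal : ℝ≥0) : ℝ) :=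
      NNReal.continuous_coe.comp continuous_real_toNNReal
    exact (Real.continuous_exp.comp (continuous_const.mul h1)).smul
      (b.continuous.comp continuous_real_toNNReal)
  let Ψ : BoundedContinuousFunction ℝ≥0 H → BoundedContinuousFunction ℝ≥0 H := fun b =>
    BoundedContinuousFunction.ofNormedAddCommGroup
      (fun t : ℝ≥0 => Real.exp (-(4 * L * t)) • N ((forcedTraj hk φ (hw b)).segment t))
      ((Real.continuous_exp.comp (by fun_prop)).smul
        (hNc.comp (Trajectory.continuous_segment _))) B fun t => by
        rw [norm_smul, Real.norm_of_nonneg (Real.exp_pos _).le]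
        refine (mul_le_of_le_one_left (norm_nonneg _) ?_).trans (hB _)
        rw [Real.exp_le_one_iff, neg_nonpos]
        positivity
  have hΨ : ContractingWith (1 / 2) Ψ := by
    refine ⟨by norm_num, LipschitzWith.of_dist_le_mul fun b c => ?_⟩
    rw [dist_eq_norm, dist_eq_norm, BoundedContinuousFunction.norm_le (by positivity)]
    intro t
    have h1 := norm_segment_sub_le hk φ (hw b) (hw c) (lam := 4 * L) (K := ‖b - c‖)
      (by positivity) (norm_nonneg _) t fun s hs => by
        simp only [w]
        rw [← smul_sub, norm_smul, Real.norm_of_nonneg (Real.exp_pos _).le,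
          Real.coe_toNNReal s hs.1, mul_comm]
        exact mul_le_mul_of_nonneg_right ((b - c).norm_coe_le_norm s.toNNReal)
          (Real.exp_pos _).le
    have h2 := (hN ((forcedTraj hk φ (hw b)).segment t)
      ((forcedTraj hk φ (hw c)).segment t)).trans (mul_le_mul_of_nonneg_left h1 hL.le)
    change ‖Real.exp (-(4 * L * t)) • N ((forcedTraj hk φ (hw b)).segment t)
      - Real.exp (-(4 * L * t)) • N ((forcedTraj hk φ (hw c)).segment t)‖ ≤ _
    rw [← smul_sub, norm_smul, Real.norm_of_nonneg (Real.exp_pos _).le, Real.exp_neg,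
      inv_mul_le_iff₀ (Real.exp_pos _)]
    refine h2.trans (le_of_eq ?_)
    push_cast
    field_simp
    norm_num
    ring
  refine ⟨w (ContractingWith.fixedPoint Ψ hΨ), hw _, fun t => ?_⟩
  have h1 : Ψ (ContractingWith.fixedPoint Ψ hΨ) = ContractingWith.fixedPoint Ψ hΨ :=
    hΨ.fixedPoint_isFixedPt
  have h2 := congrArg (fun b : BoundedContinuousFunction ℝ≥0 H => b t) h1
  change Real.exp (-(4 * L * t)) • N ((forcedTraj hk φ (hw _)).segment t) = _ at h2
  simp only [w, Real.toNNReal_coe]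
  rw [← h2, smul_smul, ← Real.exp_add, add_neg_cancel, Real.exp_zero, one_smul]

/-- Two solutions for the same locally Lipschitz force coincide. -/
theorem forcedTraj_unique {N : phaseSpace A h → H}
    (hN : ∀ r : ℝ, ∃ L : ℝ, 0 < L ∧ ∀ x y, ‖x‖ ≤ r → ‖y‖ ≤ r → ‖N x - N y‖ ≤ L * ‖x - y‖)
    (hf : Continuous f) (hg : Continuous g)
    (hff : ∀ t : ℝ≥0, f t = N ((forcedTraj hk φ hf).segment t))
    (hgg : ∀ t : ℝ≥0, g t = N ((forcedTraj hk φ hg).segment t)) :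
    forcedTraj hk φ hf = forcedTraj hk φ hg := by
  refine Trajectory.ext_of_segment fun a => ?_
  have hbdd : ∀ u : Trajectory A h, ∃ r, ∀ t : ℝ≥0, t ≤ a → ‖u.segment t‖ ≤ r := by
    intro u
    obtain ⟨r, hr⟩ := (isCompact_Icc (a := (0 : ℝ≥0)) (b := a)).bddAbove_image
      u.continuous_segment.norm.continuousOn
    exact ⟨r, fun t ht => hr (mem_image_of_mem _ ⟨zero_le, ht⟩)⟩
  obtain ⟨r₁, hr₁⟩ := hbdd (forcedTraj hk φ hf)
  obtain ⟨r₂, hr₂⟩ := hbdd (forcedTraj hk φ hg)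
  obtain ⟨L, hL, hNL⟩ := hN (max r₁ r₂)
  -- the weighted distance of the forcing terms attains its maximum `m`, and `m ≤ m / 2`
  obtain ⟨s₀, hs₀, hmax⟩ := (isCompact_Icc (a := (0 : ℝ)) (b := a)).exists_isMaxOn
    (nonempty_Icc.2 a.coe_nonneg)
    (f := fun s => Real.exp (-(4 * L * s)) * ‖f s - g s‖)
    ((Real.continuous_exp.comp (by fun_prop)).mul (hf.sub hg).norm).continuousOn
  lift s₀ to ℝ≥0 using hs₀.1
  set m := Real.exp (-(4 * L * s₀)) * ‖f s₀ - g s₀‖ with hm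
  have hm0 : 0 ≤ m := by positivity
  have h1 : ∀ s ∈ Icc 0 (a : ℝ), ‖f s - g s‖ ≤ m * Real.exp (4 * L * s) := by
    intro s hs
    have h2 : Real.exp (-(4 * L * s)) * ‖f s - g s‖ ≤ m := hmax hs
    rwa [Real.exp_neg, inv_mul_le_iff₀ (Real.exp_pos _), mul_comm] at h2
  have hz : m ≤ 0 := by
    have h3 := norm_segment_sub_le hk φ hf hg (lam := 4 * L) (by positivity) hm0 s₀
      fun s hs => h1 s ⟨hs.1, hs.2.trans hs₀.2⟩
    have ha : s₀ ≤ a := NNReal.coe_le_coe.1 hs₀.2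
    have h4 := hNL _ _ ((hr₁ _ ha).trans (le_max_left _ _)) ((hr₂ _ ha).trans (le_max_right _ _))
    rw [← hff, ← hgg] at h4
    have h5 := h4.trans (mul_le_mul_of_nonneg_left h3 hL.le)
    have h6 : m ≤ m / 2 := by
      refine hm.le.trans ?_
      rw [Real.exp_neg, inv_mul_le_iff₀ (Real.exp_pos _)]
      refine h5.trans (le_of_eq ?_)
      field_simp
      ring
    linarith
  have h7 := norm_segment_sub_le hk φ hf hg (lam := 4 * L) (K := 0) (by positivity) le_rfl a
    fun s hs => (h1 s hs).trans (mul_le_mul_of_nonneg_right hz (Real.exp_pos _).le)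
  simp only [mul_zero, zero_div, zero_mul] at h7
  exact sub_eq_zero.1 (norm_le_zero_iff.1 h7)

end Trajectory

/-! ### Radial truncation -/

section Radial

variable {E : Type*} [NormedAddCommGroup E] [NormedSpace ℝ E] {r : ℝ}

/-- The radial retraction onto the closed ball of radius `r`. -/
def radial (r : ℝ) (x : E) : E := (r / max r ‖x‖) • x

theorem radial_of_norm_le (hr : 0 < r) {x : E} (hx : ‖x‖ ≤ r) : radial r x = x := by
  rw [radial, max_eq_left hx, div_self hr.ne', one_smul]

theorem norm_radial_le (hr : 0 < r) (x : E) : ‖radial r x‖ ≤ r := by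
  have hm : 0 < max r ‖x‖ := hr.trans_le (le_max_left _ _)
  rw [radial, norm_smul, Real.norm_of_nonneg (by positivity), div_mul_eq_mul_div, div_le_iff₀ hm]
  exact mul_le_mul_of_nonneg_left (le_max_right _ _) hr.le

theorem norm_radial_sub_le (hr : 0 < r) (x y : E) : ‖radial r x - radial r y‖ ≤ 2 * ‖x - y‖ := by
  set a := max r ‖x‖ with ha
  set b := max r ‖y‖ with hb
  have ha0 : 0 < a := hr.trans_le (le_max_left _ _)
  have hb0 : 0 < b := hr.trans_le (le_max_left _ _)
  have h1 : radial r x - radial r y = (r / a) • (x - y) + ((b - a) / a) • radial r y := by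
    have h2 : ((b - a) / a) * (r / b) = r / a - r / b := by field_simp
    rw [radial, radial, ← ha, ← hb, smul_smul, h2, smul_sub, sub_smul]
    abel
  have hab : |b - a| ≤ ‖x - y‖ := by
    have h2 : |max r ‖y‖ - max r ‖x‖| ≤ |‖y‖ - ‖x‖| := by
      simpa using abs_max_sub_max_le_max r ‖y‖ r ‖x‖
    refine h2.trans ?_
    rw [norm_sub_rev]
    exact abs_norm_sub_norm_le y x
  have hra : r / a ≤ 1 := (div_le_one ha0).2 (le_max_left _ _)
  have h3 : ‖((b - a) / a) • radial r y‖ ≤ ‖x - y‖ := by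
    rw [norm_smul, norm_div, Real.norm_eq_abs, Real.norm_of_nonneg ha0.le]
    calc |b - a| / a * ‖radial r y‖ ≤ |b - a| / a * a := by
          gcongr
          exact (norm_radial_le hr y).trans (le_max_left _ _)
      _ = |b - a| := div_mul_cancel₀ _ ha0.ne'
      _ ≤ ‖x - y‖ := hab
  have h4 : ‖(r / a) • (x - y)‖ ≤ ‖x - y‖ := by
    rw [norm_smul, Real.norm_of_nonneg (by positivity)]
    exact mul_le_of_le_one_left (norm_nonneg _) hra
  rw [h1]
  exact (norm_add_le _ _).trans (by linarith)

end Radial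

/-! ### Consequences of the hypotheses on `F` -/

section Nonlinearity

variable {A : PositiveDiscreteOperator H} {F Fstar : A.V → H} {P0 P1 : A.V → ℝ}

/-- Lower powers of `A` are small perturbations of `A^{1/2}`, up to the norm of `H`. -/
theorem exists_norm_pow_sq_le (A : PositiveDiscreteOperator H) {δ : ℝ} (hδ : 0 < δ) {ε : ℝ}
    (hε : 0 < ε) : ∃ C : ℝ, 0 ≤ C ∧ ∀ u : A.V,
      ‖A.pow (1 / 2 - δ) (A.toPow (1 / 2 - δ) (by linarith) u)‖ ^ 2
        ≤ ε * ‖u‖ ^ 2 + C * ‖A.incl u‖ ^ 2 := by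
  have hlim : Tendsto (fun n => (A.μ n ^ (-δ)) ^ 2) atTop (𝓝 0) := by
    simpa using ((tendsto_rpow_neg_atTop hδ).comp A.μ_tendsto).pow 2
  obtain ⟨N, hN⟩ := eventually_atTop.1 (hlim.eventually (ge_mem_nhds hε))
  refine ⟨A.μ N * (A.μ 0 ^ (-δ)) ^ 2, mul_nonneg (A.μ_pos N).le (sq_nonneg _), fun u => ?_⟩
  refine hasSum_le (fun n => ?_) (A.hasSum_coord_sq _)
    (((A.hasSum_freq_mul_coord_sq u).mul_left ε).add ((A.hasSum_coord_sq (A.incl u)).mul_left _))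
  have h1 : A.coord n (A.pow (1 / 2 - δ) (A.toPow (1 / 2 - δ) (by linarith) u))
      = A.freq n * A.μ n ^ (-δ) * A.coord n (A.incl u) := by
    have h0 : A.μ n ^ (1 / 2 - δ) = A.freq n * A.μ n ^ (-δ) := by
      rw [sub_eq_add_neg, Real.rpow_add (A.μ_pos n), PositiveDiscreteOperator.freq]
    rw [A.coord_eq_repr, A.repr_pow, h0, A.coord_eq_repr]
    rfl
  rw [h1, mul_pow, mul_pow, mul_pow, A.freq_sq, ← mul_assoc, ← add_mul]
  refine mul_le_mul_of_nonneg_right ?_ (sq_nonneg _)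
  have hn := A.μ_pos n
  rcases le_total N n with h | h
  · have h2 := mul_le_mul_of_nonneg_left (hN n h) hn.le
    have h3 := mul_nonneg (A.μ_pos N).le (sq_nonneg (A.μ 0 ^ (-δ)))
    linarith
  · have h2 : (A.μ n ^ (-δ)) ^ 2 ≤ (A.μ 0 ^ (-δ)) ^ 2 :=
      pow_le_pow_left₀ (Real.rpow_nonneg hn.le _) (Real.rpow_le_rpow_of_nonpos (A.μ_pos 0)
        (A.μ_mono (Nat.zero_le n)) (by linarith)) 2
    have h3 := mul_le_mul (A.μ_mono h) h2 (sq_nonneg _) (A.μ_pos N).le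
    have h4 := mul_pos hε hn
    linarith

theorem HypF3.exists_norm_Fstar_sq_le (hF3 : HypF3 A F Fstar P0) (hP0 : ∀ u, 0 ≤ P0 u) {ε : ℝ}
    (hε : 0 < ε) : ∃ C : ℝ, 0 ≤ C ∧ ∀ u, ‖Fstar u‖ ^ 2 ≤ ε * (‖u‖ ^ 2 + P0 u) + C := by
  obtain ⟨δ, c₆, c₇, hδ, h6, h7, hsub⟩ := hF3.subcritical
  obtain ⟨C₁, hC₁, h1⟩ := exists_norm_pow_sq_le A hδ (ε := ε / (2 * (c₇ + 1))) (by positivity)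
  obtain ⟨C₂, hC₂, h2⟩ := hF3.lower (ε / (2 * (c₇ + 1) * (C₁ + 1))) (by positivity)
  refine ⟨c₆ + c₇ * (C₁ * C₂), by positivity, fun u => (hsub u).trans ?_⟩
  have hN : 0 ≤ ‖u‖ ^ 2 + P0 u := add_nonneg (sq_nonneg _) (hP0 u)
  have h3 := mul_le_mul_of_nonneg_left (h1 u) h7
  have h4 := mul_le_mul_of_nonneg_left (mul_le_mul_of_nonneg_left (h2 u) hC₁) h7
  have h5 : c₇ * (ε / (2 * (c₇ + 1)) * ‖u‖ ^ 2) ≤ ε / 2 * (‖u‖ ^ 2 + P0 u) := by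
    calc c₇ * (ε / (2 * (c₇ + 1)) * ‖u‖ ^ 2)
        = c₇ / (c₇ + 1) * (ε / 2 * ‖u‖ ^ 2) := by field_simp
      _ ≤ 1 * (ε / 2 * ‖u‖ ^ 2) := by
          gcongr
          rw [div_le_one (by positivity)]
          linarith
      _ ≤ ε / 2 * (‖u‖ ^ 2 + P0 u) := by
          rw [one_mul]
          gcongr
          linarith [hP0 u]
  have h6 : c₇ * (C₁ * (ε / (2 * (c₇ + 1) * (C₁ + 1)) * (‖u‖ ^ 2 + P0 u)))
      ≤ ε / 2 * (‖u‖ ^ 2 + P0 u) := by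
    calc c₇ * (C₁ * (ε / (2 * (c₇ + 1) * (C₁ + 1)) * (‖u‖ ^ 2 + P0 u)))
        = c₇ / (c₇ + 1) * (C₁ / (C₁ + 1)) * (ε / 2 * (‖u‖ ^ 2 + P0 u)) := by field_simp
      _ ≤ 1 * 1 * (ε / 2 * (‖u‖ ^ 2 + P0 u)) := by
          gcongr
          · rw [div_le_one (by positivity)]
            linarith
          · rw [div_le_one (by positivity)]
            linarith
      _ = ε / 2 * (‖u‖ ^ 2 + P0 u) := by ring
  rw [mul_add] at h3
  rw [mul_add, mul_add] at h4
  linarith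

theorem HypF3.exists_coercive (hF3 : HypF3 A F Fstar P0) (hP0 : ∀ u, 0 ≤ P0 u) :
    ∃ c C : ℝ, 0 < c ∧ 0 < C ∧
      ∀ u, -‖u‖ ^ 2 - inner ℝ (A.incl u) (F u) ≤ -(c * (‖u‖ ^ 2 + P0 u)) + C := by
  obtain ⟨η, c₄, c₅, -, hη, h4, h5, hc⟩ := hF3.coercive
  refine ⟨min (1 - η) c₄, c₅, lt_min (by linarith) h4, h5, fun u => ?_⟩
  have h1 := mul_le_mul_of_nonneg_right (min_le_left (1 - η) c₄) (sq_nonneg ‖u‖)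
  have h2 := mul_le_mul_of_nonneg_right (min_le_right (1 - η) c₄) (hP0 u)
  linarith [hc u]

theorem continuous_of_locLip {E E' : Type*} [NormedAddCommGroup E] [NormedAddCommGroup E']
    {N : E → E'} (hN : ∀ r : ℝ, ∃ L : ℝ, ∀ x y, ‖x‖ ≤ r → ‖y‖ ≤ r → ‖N x - N y‖ ≤ L * ‖x - y‖) :
    Continuous N := by
  rw [continuous_iff_continuousAt]
  intro u
  obtain ⟨L, h⟩ := hN (‖u‖ + 1)
  refine tendsto_iff_norm_sub_tendsto_zero.2 (squeeze_zero' (Eventually.of_forall fun _ =>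
    norm_nonneg _) (g := fun w => L * ‖w - u‖) ?_ ?_)
  · filter_upwards [Metric.ball_mem_nhds u one_pos] with w hw
    rw [mem_ball_iff_norm] at hw
    have h1 := norm_sub_norm_le w u
    exact h w u (by linarith) (by linarith)
  · have hc : Continuous fun w => L * ‖w - u‖ := by fun_prop
    simpa using hc.tendsto u

theorem HypF1.continuous (hF1 : HypF1 A F) : Continuous F := by
  refine continuous_of_locLip fun r => ?_
  obtain ⟨L, -, h⟩ := hF1 (max r 1) (by positivity)
  exact ⟨L, fun x y hx hy => h x y (hx.trans (le_max_left _ _)) (hy.trans (le_max_left _ _))⟩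

theorem HypF1.exists_norm_le (hF1 : HypF1 A F) (r : ℝ) : ∃ C : ℝ, ∀ u, ‖u‖ ≤ r → ‖F u‖ ≤ C := by
  obtain ⟨L, hL, h⟩ := hF1 (max r 1) (by positivity)
  refine ⟨‖F 0‖ + L * max r 1, fun u hu => ?_⟩
  have hu' : ‖u‖ ≤ max r 1 := hu.trans (le_max_left _ _)
  have h1 := h u 0 hu' (by rw [norm_zero]; positivity)
  rw [sub_zero] at h1
  have h2 := norm_le_norm_add_norm_sub' (F u) (F 0)
  have h3 := mul_le_mul_of_nonneg_left hu' hL.le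
  linarith

theorem HypF2.Fstar_locLip (hF2 : HypF2 A F Fstar P0 P1) : HypF1 A Fstar := by
  obtain ⟨c₀, hc, h⟩ := hF2.lipschitz
  refine fun _ _ => ⟨√c₀ + 1, by positivity, fun u₁ u₂ _ _ => ?_⟩
  have h1 : ‖Fstar u₁ - Fstar u₂‖ ≤ √c₀ * ‖u₁ - u₂‖ := by
    refine (sq_le_sq₀ (norm_nonneg _) (by positivity)).1 ?_
    rw [mul_pow, Real.sq_sqrt hc]
    exact h u₁ u₂
  linarith [norm_nonneg (u₁ - u₂)]

theorem HypF2.hasDerivAt_potential (hF1 : HypF1 A F) (hF2 : HypF2 A F Fstar P0 P1) {k : ℝ}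
    {f : ℝ → H} {u : ℝ → A.V} {v : ℝ → H} (hU : A.IsModalSolution k f u v) (t : ℝ) :
    HasDerivAt (fun s => P0 (u s) + P1 (u s)) (inner ℝ (F (u t) - Fstar (u t)) (v t)) t := by
  refine hU.hasDerivAt_potential (P := fun w => P0 w + P1 w) (K := fun x => F x - Fstar x)
    hF2.contDiff (fun x w => ?_) (hF1.continuous.sub hF2.Fstar_locLip.continuous) (fun r => ?_) t
  · rw [inner_sub_left, hF2.decomp]
    ring
  · obtain ⟨C, hC⟩ := hF1.exists_norm_le r
    obtain ⟨C', hC'⟩ := hF2.Fstar_locLip.exists_norm_le r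
    exact ⟨C + C', fun x hx => (norm_sub_le _ _).trans (add_le_add (hC x hx) (hC' x hx))⟩

end Nonlinearity

/-! ### The delay integral -/

section DelayIntegral

variable {q : ℝ → ℝ}

/-- `∫_{t-h}^t q`. -/
def window (q : ℝ → ℝ) (h t : ℝ) : ℝ := ∫ s in (t - h)..t, q s

/-- `∫_0^h (∫_{t-s}^t q) ds`, written through primitives so that its derivative can be read
off. -/
def doubleWindow (q : ℝ → ℝ) (h t : ℝ) : ℝ :=
  h * (∫ s in (0 : ℝ)..t, q s) - ∫ r in (t - h)..t, ∫ s in (0 : ℝ)..r, q s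

theorem hasDerivAt_doubleWindow (hq : Continuous q) (h t : ℝ) :
    HasDerivAt (doubleWindow q h) (h * q t - window q h t) t := by
  have hI : Continuous fun r => ∫ s in (0 : ℝ)..r, q s :=
    intervalIntegral.continuous_primitive (fun a b => hq.intervalIntegrable a b) 0
  have h1 : ∀ r, HasDerivAt (fun r => ∫ s in (0 : ℝ)..r, q s) (q r) r := fun r =>
    (hq.integral_hasStrictDerivAt 0 r).hasDerivAt
  have h2 : ∀ r, HasDerivAt (fun r => ∫ x in (0 : ℝ)..r, ∫ s in (0 : ℝ)..x, q s)
      (∫ s in (0 : ℝ)..r, q s) r := fun r => (hI.integral_hasStrictDerivAt 0 r).hasDerivAt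
  have h3 : HasDerivAt (fun t => ∫ x in (0 : ℝ)..(t - h), ∫ s in (0 : ℝ)..x, q s)
      (∫ s in (0 : ℝ)..(t - h), q s) t := (h2 (t - h)).comp_sub_const t h
  refine ((((h1 t).const_mul h).sub ((h2 t).sub h3)).congr_deriv ?_).congr_of_eventuallyEq
    (Eventually.of_forall fun r => ?_)
  · rw [window, intervalIntegral.integral_interval_sub_left (hq.intervalIntegrable _ _)
      (hq.intervalIntegrable _ _)]
  · simp only [doubleWindow, Pi.sub_apply]
    rw [intervalIntegral.integral_interval_sub_left (hI.intervalIntegrable _ _)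
      (hI.intervalIntegrable _ _)]

theorem window_nonneg (hq0 : ∀ s, 0 ≤ q s) {h : ℝ} (hh : 0 ≤ h) (t : ℝ) : 0 ≤ window q h t :=
  intervalIntegral.integral_nonneg (by linarith) fun s _ => hq0 s

theorem doubleWindow_mem (hq : Continuous q) (hq0 : ∀ s, 0 ≤ q s) {h : ℝ} (hh : 0 ≤ h) (t : ℝ) :
    0 ≤ doubleWindow q h t ∧ doubleWindow q h t ≤ h * window q h t := by
  have hI : Continuous fun r => ∫ s in (0 : ℝ)..r, q s :=
    intervalIntegral.continuous_primitive (fun a b => hq.intervalIntegrable a b) 0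
  have hmono : ∀ {a b : ℝ}, a ≤ b → ∫ s in (0 : ℝ)..a, q s ≤ ∫ s in (0 : ℝ)..b, q s := by
    intro a b hab
    rw [← sub_nonneg, intervalIntegral.integral_interval_sub_left (hq.intervalIntegrable _ _)
      (hq.intervalIntegrable _ _)]
    exact intervalIntegral.integral_nonneg hab fun s _ => hq0 s
  have hth : t - h ≤ t := by linarith
  have h1 : ∫ r in (t - h)..t, ∫ s in (0 : ℝ)..r, q s ≤ h * ∫ s in (0 : ℝ)..t, q s := by
    refine (intervalIntegral.integral_mono_on hth (hI.intervalIntegrable _ _)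
      intervalIntegrable_const fun r hr => hmono hr.2).trans (le_of_eq ?_)
    rw [intervalIntegral.integral_const, smul_eq_mul]
    ring
  have h2 : h * ∫ s in (0 : ℝ)..(t - h), q s ≤ ∫ r in (t - h)..t, ∫ s in (0 : ℝ)..r, q s := by
    refine le_trans (le_of_eq ?_) (intervalIntegral.integral_mono_on hth
      intervalIntegrable_const (hI.intervalIntegrable _ _) fun r hr => hmono hr.1)
    rw [intervalIntegral.integral_const, smul_eq_mul]
    ring
  refine ⟨sub_nonneg.2 h1, ?_⟩
  rw [doubleWindow, window, ← intervalIntegral.integral_interval_sub_left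
    (hq.intervalIntegrable 0 t) (hq.intervalIntegrable 0 (t - h)), mul_sub]
  linarith

/-- The Cauchy–Schwarz inequality for the mean of a function over an interval. -/
theorem sq_integral_le {g : ℝ → ℝ} (hg : Continuous g) {a b : ℝ} (hab : a ≤ b) :
    (∫ s in a..b, g s) ^ 2 ≤ (b - a) * ∫ s in a..b, g s ^ 2 := by
  rcases hab.eq_or_lt with rfl | hlt
  · simp
  set I := ∫ s in a..b, g s
  set c := I / (b - a) with hc
  have hba : 0 < b - a := sub_pos.2 hlt
  have h1 : 0 ≤ ∫ s in a..b, (g s - c) ^ 2 :=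
    intervalIntegral.integral_nonneg hab fun s _ => sq_nonneg _
  have h2 : ∫ s in a..b, (g s - c) ^ 2
      = (∫ s in a..b, g s ^ 2) - 2 * c * I + (b - a) * c ^ 2 := by
    have h3 : ∀ s, (g s - c) ^ 2 = g s ^ 2 - 2 * c * g s + c ^ 2 := fun s => by ring
    simp only [h3]
    have h4 : Continuous fun s => g s ^ 2 - 2 * c * g s := by fun_prop
    have h5 : Continuous fun s => g s ^ 2 := by fun_prop
    rw [intervalIntegral.integral_add (h4.intervalIntegrable a b) intervalIntegrable_const,
      intervalIntegral.integral_sub (h5.intervalIntegrable a b)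
      ((hg.const_mul (2 * c)).intervalIntegrable a b), intervalIntegral.integral_const_mul,
      intervalIntegral.integral_const, smul_eq_mul]
  have h4 : I = c * (b - a) := (div_mul_cancel₀ _ hba.ne').symm
  rw [h2] at h1
  have h5 := mul_nonneg hba.le h1
  rw [h4] at h5 ⊢
  nlinarith

end DelayIntegral

/-! ### Scalar inequalities for the Lyapunov function -/

/-- If `V' ≤ -ω (V - C)` on `[0, a]` then `V - C` decays exponentially there. -/
theorem le_add_mul_exp_of_deriv_le {V V' : ℝ → ℝ} {ω C a : ℝ} (hV : ∀ t, HasDerivAt V (V' t) t)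
    (hle : ∀ t ∈ Icc 0 a, V' t ≤ -ω * (V t - C)) {t : ℝ} (ht : t ∈ Icc 0 a) :
    V t ≤ C + (V 0 - C) * Real.exp (-(ω * t)) := by
  have hd : ∀ s, HasDerivAt (fun s => Real.exp (ω * s) * (V s - C))
      (Real.exp (ω * s) * (V' s + ω * (V s - C))) s := by
    intro s
    have h1 : HasDerivAt (fun s => Real.exp (ω * s)) (Real.exp (ω * s) * ω) s := by
      simpa using ((hasDerivAt_id s).const_mul ω).exp
    refine (h1.mul ((hV s).sub_const C)).congr_deriv ?_
    ring
  have hanti : AntitoneOn (fun s => Real.exp (ω * s) * (V s - C)) (Icc 0 a) := by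
    refine antitoneOn_of_deriv_nonpos (convex_Icc 0 a)
      (fun s _ => (hd s).continuousAt.continuousWithinAt)
      (fun s _ => (hd s).differentiableAt.differentiableWithinAt) fun s hs => ?_
    rw [(hd s).deriv]
    have h1 := hle s (interior_subset hs)
    exact mul_nonpos_of_nonneg_of_nonpos (Real.exp_pos _).le (by linarith)
  have h2 := hanti (left_mem_Icc.2 (ht.1.trans ht.2)) ht ht.1
  simp only [mul_zero, Real.exp_zero, one_mul] at h2
  rw [Real.exp_neg, ← div_eq_mul_inv, ← sub_le_iff_le_add', le_div_iff₀ (Real.exp_pos _), mul_comm]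
  exact h2

/-- The dissipation inequality. Here `x = ‖A^{1/2} u‖²`, `y = ‖u̇‖²`, `z = ‖u‖²`,
`N = x + Π₀(u)`, `m` bounds `‖M(u_t)‖²`, `s = ‖F*(u)‖²`, and `D` is the integral of `‖u̇‖²` over the
delay window. All gains and losses in the potential part scale like `1 / k`. -/
theorem lyapunov_deriv_le {k h L g γ c c₅ ε Cf Cz y z N D s m J uF uM : ℝ}
    (hk : 0 < k) (hh : 0 < h) (hγ : 0 ≤ γ) (hγ1 : γ ≤ 1) (hγk : 8 * γ ≤ k ^ 2)
    (hhk : 192 * L ^ 2 * h ^ 2 ≤ k ^ 2) (hε : ε * (12 * L ^ 2 + 3) ≤ γ * c / 2)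
    (hy : 0 ≤ y) (hN : 0 ≤ N) (hD : 0 ≤ D) (hz0 : 0 ≤ z) (hm0 : 0 ≤ m)
    (hJ : -J ≤ k / 4 * y + 2 / k * (s + m)) (huM : -uM ≤ (z + m) / 2)
    (hm : m ≤ 2 * g ^ 2 + 4 * L ^ 2 * z + 4 * L ^ 2 * h * D)
    (hs : s ≤ ε * N + Cf) (hz : z ≤ ε * N + Cz) (huF : uF ≤ -(c * N) + c₅) :
    -(k * y) - J + γ / k * (y + uF - uM) + k / (8 * h) * (h * y - D)
      ≤ -(k / 2 * y) - γ * c / (2 * k) * N - k / (16 * h) * D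
        + (2 * Cf + 6 * g ^ 2 + (12 * L ^ 2 + 1) * Cz + γ * c₅) / k := by
  have e1 : k / (8 * h) * (h * y - D) = k / 8 * y - 2 * (k / (16 * h) * D) := by
    field_simp
    ring
  have e2 : 12 * L ^ 2 * h * D / k ≤ k / (16 * h) * D := by
    rw [div_mul_eq_mul_div, div_le_div_iff₀ hk (by positivity)]
    nlinarith [mul_le_mul_of_nonneg_right hhk hD]
  have e3 : γ / k * y ≤ k / 8 * y := by
    refine mul_le_mul_of_nonneg_right ?_ hy
    rw [div_le_iff₀ hk]
    nlinarith
  have e4 : γ / k * (uF - uM) ≤ (γ * (-(c * N) + c₅) + (z + m) / 2) / k := by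
    rw [div_mul_eq_mul_div]
    refine div_le_div_of_nonneg_right ?_ hk.le
    have h1 := mul_le_mul_of_nonneg_left huF hγ
    have h2 := mul_le_mul_of_nonneg_left huM hγ
    have h3 := mul_le_mul_of_nonneg_right hγ1 (add_nonneg hz0 hm0)
    linarith
  have e5 : 2 * (s + m) + (γ * (-(c * N) + c₅) + (z + m) / 2)
      ≤ -(γ * c / 2 * N) + 12 * L ^ 2 * h * D
        + (2 * Cf + 6 * g ^ 2 + (12 * L ^ 2 + 1) * Cz + γ * c₅) := by
    have h1 : (12 * L ^ 2 + 1) * z ≤ (12 * L ^ 2 + 1) * (ε * N + Cz) :=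
      mul_le_mul_of_nonneg_left hz (by positivity)
    have h2 := mul_le_mul_of_nonneg_right hε hN
    linarith
  have e6 := div_le_div_of_nonneg_right e5 hk.le
  have e7 : (-(γ * c / 2 * N) + 12 * L ^ 2 * h * D
        + (2 * Cf + 6 * g ^ 2 + (12 * L ^ 2 + 1) * Cz + γ * c₅)) / k
      = -(γ * c / (2 * k) * N) + 12 * L ^ 2 * h * D / k
        + (2 * Cf + 6 * g ^ 2 + (12 * L ^ 2 + 1) * Cz + γ * c₅) / k := by
    field_simp
  have e8 : (2 * (s + m) + (γ * (-(c * N) + c₅) + (z + m) / 2)) / k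
      = 2 / k * (s + m) + (γ * (-(c * N) + c₅) + (z + m) / 2) / k := by
    field_simp
  have e9 : γ / k * (y + uF - uM) = γ / k * y + γ / k * (uF - uM) := by ring
  rw [e1, e9]
  rw [e7, e8] at e6
  linarith

/-- The dissipation inequality in closed form: a decay rate proportional to `1 / k`, against a
source that is also proportional to `1 / k`. -/
theorem lyapunov_decay {k h γ c κ C₁ C₂ V V' y N D : ℝ} (hk : 0 < k) (hh : 0 < h) (hκ : 0 < κ)
    (hκ1 : κ ≤ 1) (hκk : 2 * κ ≤ k ^ 2) (hκc : 6 * κ ≤ γ * c) (hhk : 2 * h ≤ k)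
    (hy : 0 ≤ y) (hN : 0 ≤ N) (hD : 0 ≤ D)
    (hV : V ≤ y + 3 * N + C₂ + k / 8 * D)
    (hV' : V' ≤ -(k / 2 * y) - γ * c / (2 * k) * N - k / (16 * h) * D + C₁ / k) :
    V' ≤ -(κ / k) * (V - (C₁ + κ * C₂) / κ) := by
  have e1 : κ / k * y ≤ k / 2 * y := by
    refine mul_le_mul_of_nonneg_right ?_ hy
    rw [div_le_iff₀ hk]
    nlinarith
  have e2 : κ / k * (3 * N) ≤ γ * c / (2 * k) * N := by
    have h1 : κ / k * (3 * N) = 6 * κ / (2 * k) * N := by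
      field_simp
      ring
    rw [h1]
    gcongr
  have e3 : κ / k * (k / 8 * D) ≤ k / (16 * h) * D := by
    have h1 : κ / k * (k / 8 * D) = κ / 8 * D := by field_simp
    rw [h1]
    refine mul_le_mul_of_nonneg_right ?_ hD
    rw [div_le_div_iff₀ (by norm_num) (by positivity)]
    nlinarith
  have e4 : κ / k * ((C₁ + κ * C₂) / κ) = C₁ / k + κ / k * C₂ := by field_simp
  have e5 := mul_le_mul_of_nonneg_left hV (by positivity : 0 ≤ κ / k)
  rw [mul_add, mul_add, mul_add] at e5
  rw [mul_sub, neg_mul, neg_mul, e4]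
  linarith

/-- Two-sided bounds for the Lyapunov function. -/
theorem lyapunov_bounds {k γ ε Cp Cz x y z p₀ p₁ D Q uv : ℝ}
    (hk : 0 < k) (hγ : 0 ≤ γ) (hγ1 : γ ≤ 1) (hγk : 8 * γ ≤ k ^ 2) (hε : ε ≤ 1)
    (hx : 0 ≤ x) (hy : 0 ≤ y) (hp₀ : 0 ≤ p₀) (hz0 : 0 ≤ z)
    (hp₁ : |p₁| ≤ 1 / 4 * (x + p₀) + Cp) (hz : z ≤ ε * (x + p₀) + Cz)
    (huv : |uv| ≤ k / 2 * z + y / (2 * k)) (hQ0 : 0 ≤ Q) (hQ : Q ≤ k / 8 * D) :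
    1 / 4 * (x + y) - Cp ≤ 1 / 2 * (x + y) + (p₀ + p₁) + γ / k * (uv + k / 2 * z) + Q ∧
    1 / 2 * (x + y) + (p₀ + p₁) + γ / k * (uv + k / 2 * z) + Q
      ≤ y + 3 * (x + p₀) + (Cp + Cz) + k / 8 * D := by
  rw [abs_le] at hp₁ huv
  have hgk : 0 ≤ γ / k := by positivity
  have e1 : γ / k * (y / (2 * k)) ≤ 1 / 16 * y := by
    have h1 : γ / k * (y / (2 * k)) = γ * y / (2 * k ^ 2) := by field_simp
    rw [h1, div_le_iff₀ (by positivity)]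
    nlinarith [mul_le_mul_of_nonneg_right hγk hy]
  have e2 : γ / k * (k / 2 * z) = γ / 2 * z := by field_simp
  have h1 := mul_le_mul_of_nonneg_left huv.1 hgk
  have h2 := mul_le_mul_of_nonneg_left huv.2 hgk
  have h3 := mul_le_mul_of_nonneg_right hγ1 hz0
  have h4 : ε * (x + p₀) ≤ 1 * (x + p₀) := mul_le_mul_of_nonneg_right hε (by positivity)
  rw [mul_neg, mul_add] at h1
  rw [mul_add] at h2
  rw [mul_add]
  constructor <;> linarith

/-! ### The energy estimate -/

theorem abs_inner_le_young {E : Type*} [NormedAddCommGroup E] [InnerProductSpace ℝ E] (a b : E)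
    {c : ℝ} (hc : 0 < c) :
    |inner ℝ a b| ≤ c * ‖a‖ ^ 2 + ‖b‖ ^ 2 / (4 * c) := by
  refine (abs_real_inner_le_norm a b).trans ?_
  rw [← sub_nonneg]
  have h1 : c * ‖a‖ ^ 2 + ‖b‖ ^ 2 / (4 * c) - ‖a‖ * ‖b‖ = (2 * c * ‖a‖ - ‖b‖) ^ 2 / (4 * c) := by
    field_simp
    ring
  rw [h1]
  positivity

section Estimate

variable {A : PositiveDiscreteOperator H} {F Fstar : A.V → H} {P0 P1 : A.V → ℝ} {h : ℝ≥0} {k : ℝ}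

/-- A delayed position is controlled by the present one and the velocity in the delay window. -/
theorem norm_delayed_sq_le (hk : 0 ≤ k) (φ : phaseSpace A h) {f : ℝ → H} (hf : Continuous f)
    (t : ℝ≥0) {τ : ℝ} (hτ : τ ∈ Icc (0 : ℝ) h) :
    ‖A.incl (glue hk φ f (t - τ)).1‖ ^ 2 ≤ 2 * ‖A.incl (glue hk φ f t).1‖ ^ 2
      + 2 * h * window (fun s => ‖(glue hk φ f s).2‖ ^ 2) h t := by
  have hv : Continuous fun s => (glue hk φ f s).2 := (continuous_glue hk φ hf).snd
  have hu : Continuous fun s => A.incl (glue hk φ f s).1 :=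
    A.continuous_incl.comp (continuous_glue hk φ hf).fst
  have ht := t.coe_nonneg
  have hle : (t : ℝ) - τ ≤ t := by linarith [hτ.1]
  have h1 : ∫ s in ((t : ℝ) - τ)..t, (glue hk φ f s).2
      = A.incl (glue hk φ f t).1 - A.incl (glue hk φ f (t - τ)).1 := by
    refine intervalIntegral.integral_eq_sub_of_hasDeriv_right_of_le hle hu.continuousOn
      (fun s hs => ?_) (hv.intervalIntegrable _ _)
    have hs' : -(h : ℝ) ≤ s := by linarith [hs.1, hτ.2]
    exact (hasDerivWithinAt_glue hk φ hf hs').mono fun r hr =>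
      hs'.trans (le_of_lt hr)
  have h2 : ‖∫ s in ((t : ℝ) - τ)..t, (glue hk φ f s).2‖
      ≤ ∫ s in ((t : ℝ) - τ)..t, ‖(glue hk φ f s).2‖ :=
    intervalIntegral.norm_integral_le_integral_norm hle
  have h3 := sq_integral_le hv.norm hle
  have h4 : ∫ s in ((t : ℝ) - τ)..t, ‖(glue hk φ f s).2‖ ^ 2
      ≤ window (fun s => ‖(glue hk φ f s).2‖ ^ 2) h t :=
    intervalIntegral.integral_mono_interval (by linarith [hτ.2]) hle le_rfl
      (Eventually.of_forall fun s => sq_nonneg _) ((hv.norm.pow 2).intervalIntegrable _ _)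
  have h5 : 0 ≤ window (fun s => ‖(glue hk φ f s).2‖ ^ 2) h t :=
    window_nonneg (fun s => sq_nonneg _) h.coe_nonneg t
  rw [sub_sub_cancel] at h3
  have h6 : ‖A.incl (glue hk φ f t).1 - A.incl (glue hk φ f (t - τ)).1‖ ^ 2
      ≤ h * window (fun s => ‖(glue hk φ f s).2‖ ^ 2) h t := by
    rw [← h1]
    refine (pow_le_pow_left₀ (norm_nonneg _) h2 2).trans (h3.trans ?_)
    exact (mul_le_mul_of_nonneg_left h4 hτ.1).trans (mul_le_mul_of_nonneg_right hτ.2 h5)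
  have h7 := norm_sub_norm_le (A.incl (glue hk φ f (t - τ)).1) (A.incl (glue hk φ f t).1)
  rw [norm_sub_rev] at h7
  have h8 := norm_nonneg (A.incl (glue hk φ f (t - τ)).1)
  have h9 : ‖A.incl (glue hk φ f (t - τ)).1‖ ^ 2 ≤ (‖A.incl (glue hk φ f t).1‖
      + ‖A.incl (glue hk φ f t).1 - A.incl (glue hk φ f (t - τ)).1‖) ^ 2 :=
    pow_le_pow_left₀ h8 (by linarith) 2
  nlinarith [sq_nonneg (‖A.incl (glue hk φ f t).1‖
    - ‖A.incl (glue hk φ f t).1 - A.incl (glue hk φ f (t - τ)).1‖)]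

/-- The growth of a delay term with values `G (u (t - τ))`. -/
theorem HypM3.norm_sq_le {G : H → H} {L : ℝ≥0} (hG : LipschitzWith L G)
    {M : phaseSpace A h → H} (hM : HypM3 A h G M) (hk : 0 ≤ k) (φ : phaseSpace A h)
    {f : ℝ → H} (hf : Continuous f) (t : ℝ≥0) :
    ‖M ((forcedTraj hk φ hf).segment t)‖ ^ 2 ≤ 2 * ‖G 0‖ ^ 2
      + 4 * (L : ℝ) ^ 2 * ‖A.incl (glue hk φ f t).1‖ ^ 2
      + 4 * (L : ℝ) ^ 2 * h * window (fun s => ‖(glue hk φ f s).2‖ ^ 2) h t := by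
  obtain ⟨τ, hτ⟩ := hM
  rw [hτ, forcedTraj_segment_pos]
  have h1 := norm_delayed_sq_le hk φ hf t (τ ((forcedTraj hk φ hf).segment t)).2
  rw [sub_eq_add_neg] at h1
  set w := A.incl (glue hk φ f (t + -(τ ((forcedTraj hk φ hf).segment t) : ℝ))).1
  have h2 : ‖G w‖ ≤ ‖G 0‖ + L * ‖w‖ := by
    have h3 := hG.norm_sub_le w 0
    rw [sub_zero] at h3
    linarith [norm_le_norm_add_norm_sub' (G w) (G 0)]
  have h3 := pow_le_pow_left₀ (norm_nonneg _) h2 2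
  have h4 := mul_le_mul_of_nonneg_left h1 (sq_nonneg (L : ℝ))
  nlinarith [sq_nonneg (‖G 0‖ - L * ‖w‖)]

/-- The Lyapunov function: energy, a multiple `γ / k` of the virial term, and the delay integral
with weight `k / (8 h)`. -/
def lyapunov (P0 P1 : A.V → ℝ) (γ : ℝ) (hk : 0 ≤ k) (φ : phaseSpace A h) (f : ℝ → H) (t : ℝ) : ℝ :=
  let U := A.linSol hk (initState φ) f t
  1 / 2 * (‖U.1‖ ^ 2 + ‖U.2‖ ^ 2) + (P0 U.1 + P1 U.1)
    + γ / k * (inner ℝ (A.incl U.1) U.2 + k / 2 * ‖A.incl U.1‖ ^ 2)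
    + k / (8 * h) * doubleWindow (fun s => ‖(glue hk φ f s).2‖ ^ 2) h t

/-- The derivative of the Lyapunov function along the forced linear equation. -/
def lyapunovDeriv (F Fstar : A.V → H) (γ : ℝ) (hk : 0 ≤ k) (φ : phaseSpace A h) (f : ℝ → H)
    (t : ℝ) : ℝ :=
  let U := A.linSol hk (initState φ) f t
  inner ℝ U.2 (f t - k • U.2) + inner ℝ (F U.1 - Fstar U.1) U.2
    + γ / k * (‖U.2‖ ^ 2 - ‖U.1‖ ^ 2 + inner ℝ (A.incl U.1) (f t - k • U.2)
      + k * inner ℝ (A.incl U.1) U.2)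
    + k / (8 * h) * (h * ‖(glue hk φ f t).2‖ ^ 2
      - window (fun s => ‖(glue hk φ f s).2‖ ^ 2) h t)

theorem hasDerivAt_lyapunov (hF1 : HypF1 A F) (hF2 : HypF2 A F Fstar P0 P1) (γ : ℝ) (hk : 0 ≤ k)
    (φ : phaseSpace A h) {f : ℝ → H} (hf : Continuous f) (t : ℝ) :
    HasDerivAt (lyapunov P0 P1 γ hk φ f)
      (lyapunovDeriv F Fstar γ hk φ f t) t := by
  have hU := PositiveDiscreteOperator.isModalSolution_linSol hk (initState φ) hf
  have hq : Continuous fun s => ‖(glue hk φ f s).2‖ ^ 2 :=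
    (continuous_glue hk φ hf).snd.norm.pow 2
  have h1 := (hU.hasDerivAt_energy t).const_mul (1 / 2)
  have h2 := hF2.hasDerivAt_potential hF1 hU t
  have h3 := ((hU.hasDerivAt_inner t).add
    ((hU.hasDerivAt_incl t).norm_sq.const_mul (k / 2))).const_mul (γ / k)
  have h4 := (hasDerivAt_doubleWindow hq h t).const_mul (k / (8 * h))
  refine (((h1.add h2).add h3).add h4).congr_deriv ?_
  simp only [lyapunovDeriv]
  ring

/-- The derivative of the Lyapunov function along a solution of the nonlinear equation. -/
theorem lyapunovDeriv_eq {M : phaseSpace A h → H} (γ : ℝ) (hk : 0 ≤ k) (φ : phaseSpace A h)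
    {f : ℝ → H} (hf : Continuous f) (t : ℝ≥0)
    (hft : f t = force F M ((forcedTraj hk φ hf).segment t)) :
    lyapunovDeriv F Fstar γ hk φ f t
    = let U := A.linSol hk (initState φ) f t;
      -(k * ‖U.2‖ ^ 2) - (inner ℝ U.2 (M ((forcedTraj hk φ hf).segment t))
          + inner ℝ U.2 (Fstar U.1))
        + γ / k * (‖U.2‖ ^ 2 + (-‖U.1‖ ^ 2 - inner ℝ (A.incl U.1) (F U.1))
          - inner ℝ (A.incl U.1) (M ((forcedTraj hk φ hf).segment t)))
        + k / (8 * h) * (h * ‖U.2‖ ^ 2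
          - window (fun s => ‖(glue hk φ f s).2‖ ^ 2) h t) := by
  rw [force_segment, forcedTraj_state] at hft
  simp only [lyapunovDeriv]
  rw [hft, glue_of_nonneg hk φ t.coe_nonneg]
  simp only [inner_sub_left, inner_sub_right, inner_neg_right, inner_add_right, inner_smul_right,
    real_inner_self_eq_norm_sq]
  rw [real_inner_comm (F (A.linSol hk (initState φ) f t).1),
    real_inner_comm (Fstar (A.linSol hk (initState φ) f t).1)]
  ring

/-- Dissipativity of the energy, with a bound `C` that depends neither on `k ≥ k₀` nor on the
delay. -/
theorem exists_energy_bound (hF1 : HypF1 A F) (hF2 : HypF2 A F Fstar P0 P1)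
    (hF3 : HypF3 A F Fstar P0) {G : H → H} {L : ℝ≥0} (hG : LipschitzWith L G) {k₀ : ℝ}
    (hk₀ : 0 < k₀) :
    ∃ C κ : ℝ, 0 < C ∧ 0 < κ ∧ ∀ (k : ℝ) (hk : 0 ≤ k), k₀ ≤ k → ∀ h : ℝ≥0, 0 < h →
      (h : ℝ) ≤ 1 / (16 * (L + 1)) * k₀ → ∀ ρ : ℝ, ∃ K : ℝ, 0 ≤ K ∧
        ∀ M : phaseSpace A h → H, HypM3 A h G M → ∀ φ : phaseSpace A h, ‖φ‖ ≤ ρ →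
          ∀ (f : ℝ → H) (hf : Continuous f) (a : ℝ≥0),
            (∀ t : ℝ≥0, t ≤ a → f t = force F M ((forcedTraj hk φ hf).segment t)) →
              ∀ t : ℝ≥0, t ≤ a → ‖(A.linSol hk (initState φ) f t).1‖ ^ 2
                + ‖(A.linSol hk (initState φ) f t).2‖ ^ 2
                  ≤ C + K * Real.exp (-(κ / k * t)) := by
  obtain ⟨c, c₅, hc, hc₅, hcoer⟩ := hF3.exists_coercive hF2.nonneg
  -- `8 γ ≤ k²` lets the damping absorb the `‖u̇‖²` produced by the virial term
  set γ : ℝ := min 1 (k₀ ^ 2 / 8) with hγdef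
  have hγ : 0 < γ := lt_min one_pos (by positivity)
  have hγ1 : γ ≤ 1 := min_le_left _ _
  have hγk₀ : γ ≤ k₀ ^ 2 / 8 := min_le_right _ _
  -- lower order terms may take up half of the coercivity `γ c / k` of the virial term
  set ε : ℝ := min 1 (γ * c / 2 / (12 * (L : ℝ) ^ 2 + 3)) with hεdef
  have hε : 0 < ε := lt_min one_pos (by positivity)
  have hε1 : ε ≤ 1 := min_le_left _ _
  have hεc : ε * (12 * (L : ℝ) ^ 2 + 3) ≤ γ * c / 2 :=
    (le_div_iff₀ (by positivity)).1 (min_le_right _ _)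
  obtain ⟨Cf, hCf, hFs⟩ := hF3.exists_norm_Fstar_sq_le hF2.nonneg hε
  obtain ⟨Cz, hCz, hz⟩ := hF3.lower ε hε
  obtain ⟨Cp, hCp, hp⟩ := hF2.small (1 / 4) (by norm_num)
  -- `κ / k` is the decay rate
  set κ : ℝ := min 1 (min (k₀ ^ 2 / 2) (γ * c / 6)) with hκdef
  have hκ : 0 < κ := lt_min one_pos (lt_min (by positivity) (by positivity))
  have hκ1 : κ ≤ 1 := min_le_left _ _
  have hκk₀ : κ ≤ k₀ ^ 2 / 2 := (min_le_right _ _).trans (min_le_left _ _)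
  have hκc : κ ≤ γ * c / 6 := (min_le_right _ _).trans (min_le_right _ _)
  set C₁ : ℝ := 2 * Cf + 6 * ‖G 0‖ ^ 2 + (12 * (L : ℝ) ^ 2 + 1) * Cz + γ * c₅ with hC₁
  set C₂ : ℝ := Cp + Cz with hC₂
  set C₃ : ℝ := (C₁ + κ * C₂) / κ with hC₃def
  have hC₃ : 0 ≤ C₃ := by positivity
  refine ⟨4 * (C₃ + Cp), κ, by positivity, hκ, fun k hk hkk h hh hhβ ρ => ?_⟩
  have hk0 : 0 < k := hk₀.trans_le hkk
  have hh0 : (0 : ℝ) < h := hh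
  have hksq : k₀ ^ 2 ≤ k ^ 2 := pow_le_pow_left₀ hk₀.le hkk 2
  -- the smallness of the delay, in the form in which it is used
  have hhk16 : 16 * ((L : ℝ) + 1) * h ≤ k := by
    rw [one_div_mul_eq_div, le_div_iff₀ (by positivity)] at hhβ
    linarith
  have hL0 : (0 : ℝ) ≤ L := L.coe_nonneg
  have hLh : 0 ≤ (L : ℝ) * h := mul_nonneg hL0 hh0.le
  have hhk : 192 * (L : ℝ) ^ 2 * (h : ℝ) ^ 2 ≤ k ^ 2 := by
    have h1 : (16 * ((L : ℝ) * h)) ^ 2 ≤ k ^ 2 :=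
      pow_le_pow_left₀ (by positivity) (by nlinarith) 2
    nlinarith [sq_nonneg ((L : ℝ) * h)]
  have hhk2 : 2 * (h : ℝ) ≤ k := by nlinarith
  obtain ⟨CP, hCP⟩ := hF2.bounded ρ
  set K₀ : ℝ := ρ ^ 2 + 3 * (ρ ^ 2 + CP) + C₂ + k / 8 * (h * ρ ^ 2) with hK₀
  refine ⟨4 * |K₀|, by positivity, fun M hM φ hφ f hf a hfa => ?_⟩
  set q : ℝ → ℝ := fun s => ‖(glue hk φ f s).2‖ ^ 2 with hqdef
  have hq : Continuous q := (continuous_glue hk φ hf).snd.norm.pow 2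
  have hq0 : ∀ s, 0 ≤ q s := fun s => sq_nonneg _
  have hbounds : ∀ t : ℝ≥0,
      1 / 4 * (‖(A.linSol hk (initState φ) f t).1‖ ^ 2
          + ‖(A.linSol hk (initState φ) f t).2‖ ^ 2) - Cp ≤ lyapunov P0 P1 γ hk φ f t ∧
      lyapunov P0 P1 γ hk φ f t ≤ ‖(A.linSol hk (initState φ) f t).2‖ ^ 2
        + 3 * (‖(A.linSol hk (initState φ) f t).1‖ ^ 2 + P0 (A.linSol hk (initState φ) f t).1)
        + C₂ + k / 8 * window q h t := by
    intro t
    have hdw := doubleWindow_mem hq hq0 hh0.le t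
    refine lyapunov_bounds hk0 hγ.le hγ1 (by linarith) hε1 (sq_nonneg _) (sq_nonneg _)
      (hF2.nonneg _) (sq_nonneg _) (hp _) ((hz _).trans (by linarith)) ?_ ?_ ?_
    · refine (abs_inner_le_young _ _ (half_pos hk0)).trans (le_of_eq ?_)
      ring
    · exact mul_nonneg (by positivity) hdw.1
    · refine (mul_le_mul_of_nonneg_left hdw.2 (by positivity)).trans (le_of_eq ?_)
      field_simp
  have hdecay : ∀ s ∈ Icc 0 (a : ℝ), lyapunovDeriv F Fstar γ hk φ f s
      ≤ -(κ / k) * (lyapunov P0 P1 γ hk φ f s - C₃) := by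
    intro s hs
    lift s to ℝ≥0 using hs.1
    have hsa : s ≤ a := NNReal.coe_le_coe.1 hs.2
    refine lyapunov_decay (γ := γ) (c := c)
      (y := ‖(A.linSol hk (initState φ) f s).2‖ ^ 2)
      (N := ‖(A.linSol hk (initState φ) f s).1‖ ^ 2 + P0 (A.linSol hk (initState φ) f s).1)
      (D := window q h s) hk0 hh0 hκ hκ1 (by linarith) (by linarith) hhk2 (sq_nonneg _)
      (add_nonneg (sq_nonneg _) (hF2.nonneg _)) (window_nonneg hq0 hh0.le _)
      (hbounds s).2 ?_
    refine (lyapunovDeriv_eq (Fstar := Fstar) γ hk φ hf s (hfa s hsa)).le.trans ?_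
    have hMs := hM.norm_sq_le hG hk φ hf s
    rw [glue_of_nonneg hk φ s.coe_nonneg] at hMs
    refine lyapunov_deriv_le (ε := ε) (c := c)
      (z := ‖A.incl (A.linSol hk (initState φ) f s).1‖ ^ 2)
      (m := ‖M ((forcedTraj hk φ hf).segment s)‖ ^ 2)
      (s := ‖Fstar (A.linSol hk (initState φ) f s).1‖ ^ 2)
      hk0 hh0 hγ.le hγ1 (by linarith) hhk hεc (sq_nonneg _)
      (add_nonneg (sq_nonneg _) (hF2.nonneg _)) (window_nonneg hq0 hh0.le _) (sq_nonneg _)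
      (sq_nonneg _) ?_ ?_ hMs (hFs _) ((hz _).trans (by linarith)) (hcoer _)
    · have h1 := abs_inner_le_young (A.linSol hk (initState φ) f s).2
        (M ((forcedTraj hk φ hf).segment s)) (by positivity : 0 < k / 8)
      have h2 := abs_inner_le_young (A.linSol hk (initState φ) f s).2
        (Fstar (A.linSol hk (initState φ) f s).1) (by positivity : 0 < k / 8)
      have h3 : ∀ b : ℝ, b / (4 * (k / 8)) = 2 / k * b := fun b => by
        field_simp
        ring
      rw [h3, abs_le] at h1 h2
      linarith [h1.1, h2.1]
    · have h1 := abs_inner_le_young (A.incl (A.linSol hk (initState φ) f s).1)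
        (M ((forcedTraj hk φ hf).segment s)) (by norm_num : (0 : ℝ) < 1 / 2)
      rw [abs_le] at h1
      linarith [h1.1]
  have hinit : lyapunov P0 P1 γ hk φ f 0 ≤ |K₀| := by
    refine le_trans ?_ (le_abs_self _)
    have h1 := (hbounds 0).2
    rw [NNReal.coe_zero, PositiveDiscreteOperator.linSol_zero] at h1
    have h2 : ‖(initState φ).1‖ ≤ ρ := (norm_pos_apply_le φ _).trans hφ
    have h3 : ‖(initState φ).2‖ ≤ ρ := (norm_vel_apply_le φ _).trans hφ
    have h4 := pow_le_pow_left₀ (norm_nonneg _) h2 2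
    have h5 := pow_le_pow_left₀ (norm_nonneg _) h3 2
    have h6 := hCP _ h2
    have h7 : window q h 0 ≤ h * ρ ^ 2 := by
      refine (intervalIntegral.integral_mono_on (by linarith) (hq.intervalIntegrable _ _)
        (intervalIntegrable_const (c := ρ ^ 2)) fun s hs => ?_).trans (le_of_eq ?_)
      · rw [zero_sub] at hs
        simp only [hqdef]
        rw [glue_of_mem hk φ hs]
        exact pow_le_pow_left₀ (norm_nonneg _) ((norm_vel_apply_le φ _).trans hφ) 2
      · rw [intervalIntegral.integral_const, smul_eq_mul]
        ring
    have h8 := mul_le_mul_of_nonneg_left h7 (by positivity : 0 ≤ k / 8)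
    linarith
  intro t hta
  have h1 := le_add_mul_exp_of_deriv_le (a := a)
    (fun s => hasDerivAt_lyapunov hF1 hF2 γ hk φ hf s) hdecay
    ⟨t.coe_nonneg, NNReal.coe_le_coe.2 hta⟩
  have h2 := (hbounds t).1
  have h3 : (lyapunov P0 P1 γ hk φ f 0 - C₃) * Real.exp (-(κ / k * t))
      ≤ |K₀| * Real.exp (-(κ / k * t)) :=
    mul_le_mul_of_nonneg_right (by linarith) (Real.exp_pos _).le
  linarith

end Estimate

/-! ### Well-posedness and dissipativity -/

section Evolution

variable {A : PositiveDiscreteOperator H} {F : A.V → H} {h : ℝ≥0} {k : ℝ}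

theorem exists_lipschitz_force (hF1 : HypF1 A F) {M : phaseSpace A h → H} (hM1 : HypM1 A h M)
    (r : ℝ) : ∃ L : ℝ, 0 < L ∧ ∀ x y : phaseSpace A h, ‖x‖ ≤ r → ‖y‖ ≤ r →
      ‖force F M x - force F M y‖ ≤ L * ‖x - y‖ := by
  obtain ⟨L₁, hL₁, h1⟩ := hF1 (max r 1) (by positivity)
  obtain ⟨L₂, h2⟩ := hM1 (2 * max r 1) (by positivity)
  refine ⟨L₁ + 2 * |L₂|, by positivity, fun x y hx hy => ?_⟩
  have hx' : ‖x‖ ≤ max r 1 := hx.trans (le_max_left _ _)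
  have hy' : ‖y‖ ≤ max r 1 := hy.trans (le_max_left _ _)
  have h3 := h1 _ _ ((norm_pos_apply_le x (zeroPt h)).trans hx')
    ((norm_pos_apply_le y (zeroPt h)).trans hy')
  have h4 := h2 x y ((wNorm_le_two_mul x).trans (by linarith))
    ((wNorm_le_two_mul y).trans (by linarith))
  have h5 : ‖x.1.1 (zeroPt h) - y.1.1 (zeroPt h)‖ ≤ ‖x - y‖ := norm_pos_apply_le (x - y) (zeroPt h)
  have h6 : L₂ * wNorm (x - y) ≤ |L₂| * (2 * ‖x - y‖) :=
    mul_le_mul (le_abs_self _) (wNorm_le_two_mul _) (add_nonneg (norm_nonneg _) (norm_nonneg _))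
      (abs_nonneg _)
  have h7 := mul_le_mul_of_nonneg_left h5 hL₁.le
  have h8 : force F M x - force F M y = -((F (x.1.1 (zeroPt h)) - F (y.1.1 (zeroPt h)))
      + (M x - M y)) := by
    simp only [force]
    abel
  rw [h8, norm_neg]
  refine (norm_add_le _ _).trans ?_
  linarith

theorem continuous_force (hF1 : HypF1 A F) {M : phaseSpace A h → H} (hM1 : HypM1 A h M) :
    Continuous (force F M) := by
  refine continuous_of_locLip fun r => ?_
  obtain ⟨L, -, hL⟩ := exists_lipschitz_force hF1 hM1 r
  exact ⟨L, hL⟩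

theorem norm_segment_le_of_state (hk : 0 ≤ k) (φ : phaseSpace A h) {f : ℝ → H}
    (hf : Continuous f) {t : ℝ≥0} {B : ℝ} (hφ : ‖φ‖ ≤ B)
    (hB : ∀ s : ℝ≥0, s ≤ t → ‖A.linSol hk (initState φ) f s‖ ≤ B) :
    ‖(forcedTraj hk φ hf).segment t‖ ≤ B := by
  have key : ∀ θ : DelayInterval h, ‖glue hk φ f (t + θ)‖ ≤ B := by
    intro θ
    rcases le_total ((t : ℝ) + θ) 0 with h0 | h0
    · rw [glue_of_mem hk φ ⟨by linarith [θ.2.1, t.coe_nonneg], h0⟩]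
      exact max_le ((norm_pos_apply_le φ _).trans hφ) ((norm_vel_apply_le φ _).trans hφ)
    · rw [glue_of_nonneg hk φ h0]
      have h1 : (t : ℝ) + θ ≤ t := by linarith [θ.2.2]
      exact hB ⟨_, h0⟩ h1
  exact norm_phaseSpace_le ((norm_nonneg φ).trans hφ)
    (fun θ => (norm_fst_le _).trans (key θ)) (fun θ => (norm_snd_le _).trans (key θ))

/-- An a priori bound turns local into global solvability: the solution for the radially truncated
force never reaches the sphere on which the truncation becomes active. -/
theorem exists_global_forcedTraj (hF1 : HypF1 A F) {M : phaseSpace A h → H} (hM1 : HypM1 A h M)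
    (hk : 0 ≤ k) (φ : phaseSpace A h) {B : ℝ} (hφ : ‖φ‖ ≤ B)
    (hB : ∀ (f : ℝ → H) (hf : Continuous f) (a : ℝ≥0),
      (∀ t : ℝ≥0, t ≤ a → f t = force F M ((forcedTraj hk φ hf).segment t)) →
        ∀ t : ℝ≥0, t ≤ a → ‖A.linSol hk (initState φ) f t‖ ≤ B) :
    ∃ (f : ℝ → H) (hf : Continuous f),
      ∀ t : ℝ≥0, f t = force F M ((forcedTraj hk φ hf).segment t) := by
  set r := B + 1 with hr
  have hr0 : 0 < r := by linarith [norm_nonneg φ]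
  obtain ⟨L, hL, hlip⟩ := exists_lipschitz_force hF1 hM1 r
  obtain ⟨f, hf, hfix⟩ := exists_forcedTraj_of_lipschitz hk φ
    (N := fun x => force F M (radial r x)) (L := L * 2) (B := ‖force F M 0‖ + L * r)
    (by positivity)
    (fun x y => (hlip _ _ (norm_radial_le hr0 x) (norm_radial_le hr0 y)).trans (by
      rw [mul_assoc]
      exact mul_le_mul_of_nonneg_left (norm_radial_sub_le hr0 x y) hL.le))
    (fun x => by
      have h1 := hlip _ 0 (norm_radial_le hr0 x) (norm_zero.trans_le hr0.le)
      rw [sub_zero] at h1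
      have h2 := mul_le_mul_of_nonneg_left (norm_radial_le hr0 x) hL.le
      linarith [norm_le_norm_add_norm_sub' (force F M (radial r x)) (force F M 0)])
  -- as long as the segments stay in the ball, the original equation holds
  have hstay : ∀ a : ℝ≥0, (∀ t ≤ a, ‖(forcedTraj hk φ hf).segment t‖ ≤ r) →
      ‖(forcedTraj hk φ hf).segment a‖ ≤ B := fun a ha =>
    norm_segment_le_of_state hk φ hf hφ fun s hs => hB f hf a (fun t ht =>
      (hfix t).trans (congrArg (force F M) (radial_of_norm_le hr0 (ha t ht)))) s hs
  have hlt : ∀ t, ‖(forcedTraj hk φ hf).segment t‖ < r := by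
    by_contra! hcon
    obtain ⟨t₀, ht₀⟩ := hcon
    have hcl : IsClosed {t : ℝ≥0 | r ≤ ‖(forcedTraj hk φ hf).segment t‖} :=
      isClosed_le continuous_const (forcedTraj hk φ hf).continuous_segment.norm
    have hmem := hcl.csInf_mem ⟨t₀, ht₀⟩ (OrderBot.bddBelow _)
    set t₁ := sInf {t : ℝ≥0 | r ≤ ‖(forcedTraj hk φ hf).segment t‖} with ht₁
    have hbefore : ∀ t < t₁, ‖(forcedTraj hk φ hf).segment t‖ < r := fun t ht =>
      lt_of_not_ge fun hge => notMem_of_lt_csInf ht (OrderBot.bddBelow _) hge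
    have heq : ‖(forcedTraj hk φ hf).segment t₁‖ ≤ r := by
      rcases eq_or_ne t₁ 0 with h0 | h0
      · rw [h0, forcedTraj_segment_zero]
        linarith
      · have hne : (𝓝[<] t₁).NeBot := by
          refine mem_closure_iff_nhdsWithin_neBot.1 ?_
          rw [closure_Iio' ⟨0, pos_iff_ne_zero.2 h0⟩]
          exact self_mem_Iic
        have hlim : Tendsto (fun t => ‖(forcedTraj hk φ hf).segment t‖) (𝓝[<] t₁)
            (𝓝 ‖(forcedTraj hk φ hf).segment t₁‖) :=
          ((forcedTraj hk φ hf).continuous_segment.norm.tendsto t₁).mono_left nhdsWithin_le_nhds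
        have hev : ∀ᶠ t in 𝓝[<] t₁, ‖(forcedTraj hk φ hf).segment t‖ ≤ r :=
          eventually_nhdsWithin_of_forall fun t ht => (hbefore t ht).le
        exact le_of_tendsto hlim hev
    have h1 := hstay t₁ fun t ht => ht.eq_or_lt.elim (fun e => e ▸ heq) fun hlt =>
      (hbefore t hlt).le
    have h2 : r ≤ ‖(forcedTraj hk φ hf).segment t₁‖ := hmem
    linarith
  exact ⟨f, hf, fun t =>
    (hfix t).trans (congrArg (force F M) (radial_of_norm_le hr0 (hlt t).le))⟩

/-- A solution of the fixed point equation for the forcing term gives the unique mild solution. -/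
theorem existsUnique_isMildSolution (hF1 : HypF1 A F) {M : phaseSpace A h → H}
    (hM1 : HypM1 A h M) (hk : 0 ≤ k) (φ : phaseSpace A h)
    (hex : ∃ (f : ℝ → H) (hf : Continuous f),
      ∀ t : ℝ≥0, f t = force F M ((forcedTraj hk φ hf).segment t)) :
    ∃! u : Trajectory A h, IsMildSolution (A.waveGroup hk) F M φ u := by
  obtain ⟨f, hf, hfix⟩ := hex
  refine ⟨forcedTraj hk φ hf, isMildSolution_forcedTraj hk φ hf hfix, fun u hu => ?_⟩
  have hc : Continuous fun s : ℝ => force F M (u.segment s.toNNReal) :=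
    (continuous_force hF1 hM1).comp (u.continuous_segment.comp continuous_real_toNNReal)
  have h1 := hu.eq_forcedTraj hk φ hc
  refine h1.trans (forcedTraj_unique hk φ (exists_lipschitz_force hF1 hM1) hc hf (fun t => ?_)
    hfix)
  rw [Real.toNNReal_coe, ← h1]

end Evolution

end DelayWave

end

theorem proposition3p1 {H : Type*} [NormedAddCommGroup H] [InnerProductSpace ℝ H] [CompleteSpace H]
    (A : DelayWave.PositiveDiscreteOperator H)
    (F Fstar : A.V → H) (P0 P1 : A.V → ℝ) (G : H → H)
    (hF1 : DelayWave.HypF1 A F)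
    (hF2 : DelayWave.HypF2 A F Fstar P0 P1)
    (hF3 : DelayWave.HypF3 A F Fstar P0)
    (hG : ∃ L : ℝ≥0, LipschitzWith L G) :
    ∃ β : ℝ, 0 < β ∧ ∀ k₀ : ℝ, 0 < k₀ → ∃ R : ℝ, 0 < R ∧
      ∀ k : ℝ, k₀ ≤ k →
        ∃ T : ℝ → (A.V × H) →L[ℝ] (A.V × H), DelayWave.IsWaveSemigroup A k T ∧
          ∀ h : ℝ≥0, 0 < h → (h : ℝ) ≤ β * k₀ →
            ∀ M : DelayWave.phaseSpace A h → H,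
              DelayWave.HypM1 A h M → DelayWave.HypM3 A h G M →
                ∃ S : ℝ≥0 → DelayWave.phaseSpace A h → DelayWave.phaseSpace A h,
                  DelayWave.IsEvolution T F M S ∧ DelayWave.IsDissipativeWithRadius S R := by
  obtain ⟨L, hG⟩ := hG
  refine ⟨1 / (16 * (L + 1)), by positivity, fun k₀ hk₀ => ?_⟩
  obtain ⟨C, κ, hC, hκ, hbound⟩ := DelayWave.exists_energy_bound hF1 hF2 hF3 hG hk₀
  refine ⟨2 * √(C + 1), by positivity, fun k hkk => ?_⟩
  have hk0 : 0 < k := hk₀.trans_le hkk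
  refine ⟨A.waveGroup hk0.le, A.isWaveSemigroup_waveGroup hk0.le, fun h hh hhβ M hM1 hM3 => ?_⟩
  have hex : ∀ φ : DelayWave.phaseSpace A h, ∃ (f : ℝ → H) (hf : Continuous f),
      ∀ t : ℝ≥0, f t = DelayWave.force F M ((DelayWave.forcedTraj hk0.le φ hf).segment t) := by
    intro φ
    obtain ⟨K, hK, hKb⟩ := hbound k hk0.le hkk h hh hhβ ‖φ‖
    refine DelayWave.exists_global_forcedTraj hF1 hM1 hk0.le φ (le_max_left ‖φ‖ (√(C + K)))
      fun f hf a hfa t hta => le_max_of_le_right (Real.le_sqrt_of_sq_le ?_)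
    refine (A.norm_sq_le_of_hasSum (A.hasSum_norm_mode_sq _)).trans
      ((hKb M hM3 φ le_rfl f hf a hfa t hta).trans ?_)
    have h1 : Real.exp (-(κ / k * t)) ≤ 1 := by
      rw [Real.exp_le_one_iff, neg_nonpos]
      positivity
    linarith [mul_le_mul_of_nonneg_left h1 hK]
  have huniq := fun φ => DelayWave.existsUnique_isMildSolution hF1 hM1 hk0.le φ (hex φ)
  refine ⟨fun t φ => (huniq φ).choose.segment t, fun φ => ⟨huniq φ, fun u hu t => ?_⟩,
    fun ρ hρ => ?_⟩
  · rw [(huniq φ).choose_spec.2 u hu]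
  · obtain ⟨K, hK, hKb⟩ := hbound k hk0.le hkk h hh hhβ ρ
    have hlim : Tendsto (fun t : ℝ≥0 => K * Real.exp (-(κ / k * t))) atTop (𝓝 0) := by
      have h1 : Tendsto (fun t : ℝ≥0 => κ / k * (t : ℝ)) atTop atTop :=
        (NNReal.tendsto_coe_atTop.2 tendsto_id).const_mul_atTop (div_pos hκ hk0)
      simpa using (Real.tendsto_exp_neg_atTop_nhds_zero.comp h1).const_mul K
    obtain ⟨t₁, ht₁⟩ := eventually_atTop.1 (hlim.eventually (ge_mem_nhds one_pos))
    refine ⟨t₁ + h, by positivity, fun φ hφ t ht => ?_⟩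
    obtain ⟨f, hf, hfix⟩ := hex φ
    have hu := (huniq φ).choose_spec.2 _ (DelayWave.isMildSolution_forcedTraj hk0.le φ hf hfix)
    beta_reduce at hu
    have key : ∀ θ : DelayWave.DelayInterval h, ‖DelayWave.glue hk0.le φ f (t + θ)‖ ≤ √(C + 1) := by
      intro θ
      have hθ : (t₁ : ℝ) ≤ t + θ := by
        have h1 := NNReal.coe_le_coe.2 ht
        rw [NNReal.coe_add] at h1
        linarith [θ.2.1]
      have h0 : 0 ≤ (t : ℝ) + θ := t₁.coe_nonneg.trans hθ
      rw [DelayWave.glue_of_nonneg _ φ h0]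
      refine Real.le_sqrt_of_sq_le ((A.norm_sq_le_of_hasSum (A.hasSum_norm_mode_sq _)).trans
        ((hKb M hM3 φ ((DelayWave.norm_le_wNorm φ).trans hφ) f hf ⟨_, h0⟩ (fun s _ => hfix s) ⟨_, h0⟩
          le_rfl).trans ?_))
      have h2 := ht₁ ⟨_, h0⟩ hθ
      linarith
    beta_reduce
    rw [← hu, DelayWave.wNorm, two_mul]
    refine add_le_add ((ContinuousMap.norm_le _ (Real.sqrt_nonneg _)).2 fun θ => ?_)
      ((ContinuousMap.norm_le _ (Real.sqrt_nonneg _)).2 fun θ => ?_)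
    · exact (norm_fst_le _).trans (key θ)
    · exact (norm_snd_le _).trans (key θ)
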